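/- For $N\in\mathbb N$ let $\mathcal Q_N=\{-1,1\}^N$ and let $(g_N(\sigma))_{\sigma\in\mathcal Q_N}$ be i.i.d. standard Gaussian random variables; the variables for all $N$ live on one probability space, with an arbitrary joint law for different $N$. On $\ell^2(\mathcal Q_N)$ let $(T\psi)(\sigma)=-\sum_{j=1}^N\psi(\sigma_1,\dots,-\sigma_j,\dots,\sigma_N)$, let $U(\sigma)=\sqrt N\,g_N(\sigma)$ act by multiplication, and put $H=\Gamma T+U$ and $$p_N(\beta,\Gamma)=\frac1N\ln\left(2^{-N}\,\mathrm{Tr}\,e^{-\beta H}\right).$$ Let $\beta_c=\sqrt{2\ln 2}$, let $p^{\mathrm{REM}}(\beta)=\tfrac12\beta^2$ for $\beta\le\beta_c$ and $p^{\mathrm{REM}}(\beta)=\tfrac12\beta_c^2+(\beta-\beta_c)\beta_c$ for $\beta>\beta_c$, let $p^{\mathrm{PAR}}(x)=\ln\cosh x$, and let $p(\beta,\Gamma)=\max\{p^{\mathrm{REM}}(\beta),\,p^{\mathrm{PAR}}(\beta\Gamma)\}$. (1) For all $\beta,\Gamma\ge 0$, almost surely $\lim_{N\to\infty}p_N(\beta,\Gamma)=p(\beta,\Gamma)$.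 (2) (First-order transition.) For $\beta>0$ let $\Gamma_c(\beta)=\beta^{-1}\operatorname{arcosh}\left(e^{p^{\mathrm{REM}}(\beta)}\right)$. For $\Gamma\ge0$, $p^{\mathrm{PAR}}(\beta\Gamma)<p^{\mathrm{REM}}(\beta)$ if and only if $\Gamma<\Gamma_c(\beta)$, and $p^{\mathrm{PAR}}(\beta\Gamma)>p^{\mathrm{REM}}(\beta)$ if and only if $\Gamma>\Gamma_c(\beta)$. At $\Gamma=\Gamma_c(\beta)$ the left derivative of $\Gamma\mapsto p(\beta,\Gamma)$ is $0$ and its right derivative is $\beta\tanh(\beta\Gamma_c(\beta))>0$. (3) (Freezing transition.) For $\beta>0$ and $0\le\Gamma<\Gamma_c(\beta)$ one has $\frac{\partial p}{\partial\beta}(\beta,\Gamma)=\min\{\beta,\beta_c\}$, and the limiting specific entropy $\ln 2+p-\beta\,\frac{\partial p}{\partial\beta}$ vanishes at $(\beta,\Gamma)$ if and only if $\beta\ge\beta_c$. -/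

import Mathlib

open MeasureTheory ProbabilityTheory Filter Topology

namespace QREM

/-- The configuration space `{-1, 1}^N`; the two signs are the units of `ℤ`. -/
abbrev Config (N : ℕ) : Type := Fin N → ℤˣ

/-- The flip operator `F_j`, which changes the sign of the `j`-th component. -/
def flip {N : ℕ} (j : Fin N) (σ : Config N) : Config N := Function.update σ j (-σ j)

/-- The transversal field, as a matrix on `ℓ²({-1, 1}^N)`: the lemma below gives its action
`(T ψ)(σ) = - ∑ j, ψ (F_j σ)`. -/
def transverseField (N : ℕ) : Matrix (Config N) (Config N) ℂ :=
  Matrix.of fun σ τ => -∑ j : Fin N, if τ = flip j σ then 1 else 0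

theorem transverseField_mulVec {N : ℕ} (ψ : Config N → ℂ) (σ : Config N) :
    (transverseField N).mulVec ψ σ = -∑ j : Fin N, ψ (flip j σ) := by
  simp only [transverseField, Matrix.mulVec, dotProduct, Matrix.of_apply, neg_mul,
    Finset.sum_neg_distrib, Finset.sum_mul]
  rw [Finset.sum_comm]
  simp

/-- The potential `U(σ) = √N g(σ)` for a realization `g` of the Gaussian variables. -/
noncomputable def potential {N : ℕ} (g : Config N → ℝ) (σ : Config N) : ℝ :=
  Real.sqrt N * g σ

/-- The Hamiltonian `H = Γ T + U`, where `U` acts by multiplication. -/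
noncomputable def hamiltonian {N : ℕ} (Γ : ℝ) (g : Config N → ℝ) :
    Matrix (Config N) (Config N) ℂ :=
  (Γ : ℂ) • transverseField N + Matrix.diagonal fun σ => (potential g σ : ℂ)

/-- The partition function `Z(β, Γ) = 2^(-N) Tr exp(-β H)`. As `H` is Hermitian the trace is a
real number, so taking the real part only changes the type. -/
noncomputable def partitionFunction {N : ℕ} (β Γ : ℝ) (g : Config N → ℝ) : ℝ :=
  ((2 : ℝ) ^ N)⁻¹ * (Matrix.trace (NormedSpace.exp (-(β : ℂ) • hamiltonian Γ g))).re

/-- The pressure `p_N(β, Γ) = N⁻¹ ln Z(β, Γ)`. -/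
noncomputable def pressure {N : ℕ} (β Γ : ℝ) (g : Config N → ℝ) : ℝ :=
  (N : ℝ)⁻¹ * Real.log (partitionFunction β Γ g)

/-- The freezing inverse temperature `β_c = √(2 ln 2)`. -/
noncomputable def betaC : ℝ := Real.sqrt (2 * Real.log 2)

/-- The limiting pressure of the random energy model. -/
noncomputable def pREM (β : ℝ) : ℝ :=
  if β ≤ betaC then β ^ 2 / 2 else betaC ^ 2 / 2 + (β - betaC) * betaC

/-- The pressure of the quantum paramagnet, `ln cosh`. -/
noncomputable def pPAR (x : ℝ) : ℝ := Real.log (Real.cosh x)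

/-- Goldschmidt's formula for the limiting pressure. -/
noncomputable def pQREM (β Γ : ℝ) : ℝ := max (pREM β) (pPAR (β * Γ))

/-- The critical field `Γ_c(β) = β⁻¹ arcosh (exp (p^REM(β)))`, used for `β > 0`. -/
noncomputable def gammaC (β : ℝ) : ℝ := β⁻¹ * Real.arcosh (Real.exp (pREM β))

end QREM

/-
The partition function is bounded from below by the Peierls–Bogoliubov inequality. In the basis of
configurations it gives the partition function of the random energy model; in the basis of the
characters of the hypercube, where the transversal field is diagonal, it gives the one of the
quantum paramagnet, up to the average of the potential, which is negligible.

For the upper bound, call a configuration deep if its potential is below `-ε N`. By a Chernoff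
bound, almost surely no configuration has more than `δ² N` deep neighbours once `N` is large. By
Schur's test the edges of the hypercube at deep configurations then form an operator of norm at most
`2 δ N`, so they can be removed. This isolates the deep configurations, which contribute at most the
partition function of the random energy model; on the others the potential is at least `-ε N`, and
what remains is at most the quantum paramagnet.

The random energy model is computed by the first moment for `β ≤ β_c`, by comparison of `ℓ^p` norms
for `β > β_c`, and from below by a second moment bound on the number of configurations with energy
at most `-x N`, for `x < β_c`. This makes `p^REM(β)` the supremum of `β x - x² / 2` over `x ≤ β_c`,
and `min β β_c`, where it is attained, its derivative.
-/

namespace QREM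

section TraceInequalities

open Matrix

variable {n 𝕜 : Type*} [RCLike 𝕜] [Fintype n]

theorem conj_apply_self (A V : Matrix n n 𝕜) (i : n) :
    (star V * A * V) i i = star (V.col i) ⬝ᵥ A *ᵥ V.col i := by
  rw [mul_assoc, mul_apply]
  rfl

variable [DecidableEq n]

theorem trace_star_mul_mul (U : unitaryGroup n 𝕜) (A : Matrix n n 𝕜) :
    (star (U : Matrix n n 𝕜) * A * U).trace = A.trace := by
  rw [trace_mul_comm, ← mul_assoc, Unitary.mul_star_self_of_mem U.2, one_mul]

variable {A B : Matrix n n 𝕜} {f : ℝ → ℝ}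

theorem dotProduct_cfc_mulVec (hA : A.IsHermitian) (f : ℝ → ℝ) (v : n → 𝕜) :
    star v ⬝ᵥ cfc f A *ᵥ v =
      ((∑ k, ‖(star (hA.eigenvectorUnitary : Matrix n n 𝕜) *ᵥ v) k‖ ^ 2 *
        f (hA.eigenvalues k) : ℝ) : 𝕜) := by
  set U : Matrix n n 𝕜 := hA.eigenvectorUnitary.1
  have hstar : star v ᵥ* U = star (star U *ᵥ v) := by
    rw [star_eq_conjTranspose U, star_mulVec, conjTranspose_conjTranspose]
  rw [hA.cfc_eq, IsHermitian.cfc, Unitary.conjStarAlgAut_apply, ← mulVec_mulVec, ← mulVec_mulVec,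
    dotProduct_mulVec, hstar, RCLike.ofReal_sum]
  refine Finset.sum_congr rfl fun k _ => ?_
  rw [mulVec_diagonal, Pi.star_apply, RCLike.star_def, Function.comp_apply, Function.comp_apply,
    mul_left_comm, RCLike.conj_mul, mul_comm, RCLike.ofReal_mul, RCLike.ofReal_pow]

theorem map_dotProduct_mulVec_le_of_convexOn (hA : A.IsHermitian) (hf : ConvexOn ℝ Set.univ f)
    {v : n → 𝕜} (hv : star v ⬝ᵥ v = 1) :
    f (RCLike.re (star v ⬝ᵥ A *ᵥ v)) ≤ RCLike.re (star v ⬝ᵥ cfc f A *ᵥ v) := by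
  have hid := dotProduct_cfc_mulVec hA id v
  have hone := dotProduct_cfc_mulVec hA 1 v
  rw [show cfc id A = A from cfc_id ℝ A hA] at hid
  rw [show cfc 1 A = 1 from cfc_one ℝ A hA, one_mulVec, hv] at hone
  simp only [Pi.one_apply, mul_one] at hone
  rw [hid, dotProduct_cfc_mulVec hA, RCLike.ofReal_re, RCLike.ofReal_re]
  exact hf.map_sum_le (fun _ _ => sq_nonneg _) (by exact_mod_cast hone.symm)
    fun _ _ => Set.mem_univ _

theorem sum_map_diag_conj_le_trace_cfc (hA : A.IsHermitian) (hf : ConvexOn ℝ Set.univ f)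
    (U : unitaryGroup n 𝕜) :
    ∑ i, f (RCLike.re ((star (U : Matrix n n 𝕜) * A * U) i i)) ≤ RCLike.re (cfc f A).trace := by
  rw [← trace_star_mul_mul U, trace, map_sum]
  refine Finset.sum_le_sum fun i _ => ?_
  have hcol : star ((U : Matrix n n 𝕜).col i) ⬝ᵥ (U : Matrix n n 𝕜).col i = 1 := by
    have h := conj_apply_self 1 (U : Matrix n n 𝕜) i
    rwa [mul_one, Unitary.star_mul_self_of_mem U.2, one_apply_eq, one_mulVec, eq_comm] at h
  rw [diag_apply, conj_apply_self, conj_apply_self]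
  exact map_dotProduct_mulVec_le_of_convexOn hA hf hcol

theorem trace_cfc (hA : A.IsHermitian) (f : ℝ → ℝ) :
    (cfc f A).trace = ∑ i, (f (hA.eigenvalues i) : 𝕜) := by
  rw [hA.cfc_eq, IsHermitian.cfc, Unitary.conjStarAlgAut_apply, trace_mul_comm, ← mul_assoc,
    Unitary.coe_star_mul_self, one_mul, trace_diagonal]
  rfl

theorem trace_cfc_mono (hA : A.IsHermitian) (hB : B.IsHermitian)
    (hAB : ∀ v, RCLike.re (star v ⬝ᵥ A *ᵥ v) ≤ RCLike.re (star v ⬝ᵥ B *ᵥ v))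
    (hf : ConvexOn ℝ Set.univ f) (hmono : Monotone f) :
    RCLike.re (cfc f A).trace ≤ RCLike.re (cfc f B).trace := by
  rw [trace_cfc hA, map_sum]
  refine le_trans (Finset.sum_le_sum fun i _ => ?_)
    (sum_map_diag_conj_le_trace_cfc hB hf hA.eigenvectorUnitary)
  rw [RCLike.ofReal_re, hA.eigenvalues_eq i, conj_apply_self]
  exact hmono (hAB _)

theorem exp_unitary_conj (U : unitaryGroup n 𝕜) (A : Matrix n n 𝕜) :
    NormedSpace.exp ((U : Matrix n n 𝕜) * A * star (U : Matrix n n 𝕜)) =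
      (U : Matrix n n 𝕜) * NormedSpace.exp A * star (U : Matrix n n 𝕜) := by
  have hinv : (U : Matrix n n 𝕜)⁻¹ = star (U : Matrix n n 𝕜) :=
    inv_eq_right_inv (Unitary.mul_star_self_of_mem U.2)
  rw [← hinv, exp_conj _ _ (Unitary.isUnit_coe (U := U))]

theorem cfc_exp_eq_exp (hA : A.IsHermitian) : cfc Real.exp A = NormedSpace.exp A := by
  conv_rhs => rw [hA.spectral_theorem]
  rw [hA.cfc_eq, IsHermitian.cfc, Unitary.conjStarAlgAut_apply, Unitary.conjStarAlgAut_apply,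
    exp_unitary_conj, exp_diagonal]
  congr 3
  funext i
  rw [Pi.coe_exp, Real.exp_eq_exp_ℝ]
  exact NormedSpace.algebraMap_exp_comm (𝔸 := 𝕜) (hA.eigenvalues i)

theorem sum_exp_diag_conj_le_trace_exp (hA : A.IsHermitian) (U : unitaryGroup n 𝕜) :
    ∑ i, Real.exp (RCLike.re ((star (U : Matrix n n 𝕜) * A * U) i i)) ≤
      RCLike.re (NormedSpace.exp A).trace := by
  rw [← cfc_exp_eq_exp hA]
  exact sum_map_diag_conj_le_trace_cfc hA convexOn_exp U

theorem sum_exp_diag_le_trace_exp (hA : A.IsHermitian) :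
    ∑ i, Real.exp (RCLike.re (A i i)) ≤ RCLike.re (NormedSpace.exp A).trace := by
  simpa using sum_exp_diag_conj_le_trace_exp hA 1

theorem trace_exp_mono (hA : A.IsHermitian) (hB : B.IsHermitian)
    (hAB : ∀ v, RCLike.re (star v ⬝ᵥ A *ᵥ v) ≤ RCLike.re (star v ⬝ᵥ B *ᵥ v)) :
    RCLike.re (NormedSpace.exp A).trace ≤ RCLike.re (NormedSpace.exp B).trace := by
  rw [← cfc_exp_eq_exp hA, ← cfc_exp_eq_exp hB]
  exact trace_cfc_mono hA hB hAB convexOn_exp Real.exp_monotone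

theorem exp_diagonal_real (d : n → ℝ) :
    NormedSpace.exp (diagonal d) = diagonal fun i => Real.exp (d i) := by
  rw [exp_diagonal, Real.exp_eq_exp_ℝ]
  exact congrArg diagonal (funext (Pi.coe_exp d))

theorem trace_exp_unitary_conj_diagonal (U : unitaryGroup n ℝ) (d : n → ℝ) :
    (NormedSpace.exp ((U : Matrix n n ℝ) * diagonal d * star (U : Matrix n n ℝ))).trace =
      ∑ i, Real.exp (d i) := by
  rw [exp_unitary_conj, trace_mul_comm, ← mul_assoc, Unitary.coe_star_mul_self, one_mul,
    exp_diagonal_real, trace_diagonal]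

theorem trace_exp_add_smul_one (A : Matrix n n ℝ) (c : ℝ) :
    (NormedSpace.exp (A + c • 1)).trace = Real.exp c * (NormedSpace.exp A).trace := by
  rw [Matrix.exp_add_of_commute _ _ ((Commute.one_right A).smul_right c), smul_one_eq_diagonal,
    exp_diagonal_real, ← smul_one_eq_diagonal, mul_smul_one, trace_smul, smul_eq_mul]

end TraceInequalities

section ExponentialSeries

theorem add_pow_succ_of_mul_eq_zero {R : Type*} [Semiring R] {x y : R} (hxy : x * y = 0)
    (hyx : y * x = 0) (k : ℕ) : (x + y) ^ (k + 1) = x ^ (k + 1) + y ^ (k + 1) := by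
  induction k with
  | zero => simp
  | succ k ih =>
    have hx : x ^ (k + 1) * y = 0 := by rw [pow_succ, mul_assoc, hxy, mul_zero]
    have hy : y ^ (k + 1) * x = 0 := by rw [pow_succ, mul_assoc, hyx, mul_zero]
    rw [pow_succ, ih, add_mul, mul_add, mul_add, hx, hy, ← pow_succ, ← pow_succ, add_zero,
      zero_add]

theorem exp_add_of_mul_eq_zero {R : Type*} [NormedRing R] [NormedAlgebra ℝ R] [CompleteSpace R]
    {x y : R} (hxy : x * y = 0) (hyx : y * x = 0) :
    NormedSpace.exp (x + y) = NormedSpace.exp x + NormedSpace.exp y - 1 := by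
  have hseries := NormedSpace.exp_series_hasSum_exp' (𝕂 := ℝ) (𝔸 := R)
  refine (hseries (x + y)).unique ?_
  refine (((hseries x).add (hseries y)).sub (hasSum_ite_eq 0 (1 : R))).congr_fun fun k => ?_
  cases k with
  | zero => simp
  | succ k => simp [add_pow_succ_of_mul_eq_zero hxy hyx]

theorem trace_exp_add_of_mul_eq_zero {n : Type*} [Fintype n] [DecidableEq n] {X Y : Matrix n n ℝ}
    (hXY : X * Y = 0) (hYX : Y * X = 0) :
    (NormedSpace.exp (X + Y)).trace =
      (NormedSpace.exp X).trace + (NormedSpace.exp Y).trace - Fintype.card n := by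
  have hexp : NormedSpace.exp (X + Y) = NormedSpace.exp X + NormedSpace.exp Y - 1 := by
    open scoped Matrix.Norms.Operator in exact exp_add_of_mul_eq_zero hXY hYX
  rw [hexp, Matrix.trace_sub, Matrix.trace_add, Matrix.trace_one]

variable {n 𝕜 : Type*} [RCLike 𝕜] [Fintype n] [DecidableEq n]

theorem norm_pow_apply_le {X : Matrix n n 𝕜} {A : Matrix n n ℝ} (h : ∀ i j, ‖X i j‖ ≤ A i j)
    (k : ℕ) (i j : n) : ‖(X ^ k) i j‖ ≤ (A ^ k) i j := by
  induction k generalizing j with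
  | zero => rcases eq_or_ne i j with rfl | hij <;> simp [*]
  | succ k ih =>
    rw [pow_succ, pow_succ, Matrix.mul_apply, Matrix.mul_apply]
    refine (norm_sum_le _ _).trans (Finset.sum_le_sum fun l _ => ?_)
    rw [norm_mul]
    exact mul_le_mul (ih l) (h l j) (norm_nonneg _) ((norm_nonneg _).trans (ih l))

open scoped Matrix.Norms.Operator in
theorem hasSum_trace_exp (X : Matrix n n 𝕜) :
    HasSum (fun k : ℕ => (k.factorial⁻¹ : 𝕜) * (X ^ k).trace) (NormedSpace.exp X).trace := by
  refine ((NormedSpace.exp_series_hasSum_exp' (𝕂 := 𝕜) X).map (Matrix.traceAddMonoidHom n 𝕜)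
    continuous_id.matrix_trace).congr_fun fun k => ?_
  simp only [Function.comp_apply, Matrix.traceAddMonoidHom_apply, Matrix.trace_smul, smul_eq_mul]

theorem norm_trace_exp_le {X : Matrix n n 𝕜} {A : Matrix n n ℝ} (h : ∀ i j, ‖X i j‖ ≤ A i j) :
    ‖(NormedSpace.exp X).trace‖ ≤ (NormedSpace.exp A).trace := by
  refine (hasSum_trace_exp X).norm_le_of_bounded (hasSum_trace_exp A) fun k => ?_
  rw [norm_mul, norm_inv, RCLike.norm_natCast]
  gcongr
  exact norm_sum_le_of_le _ fun i _ => norm_pow_apply_le h k i i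

end ExponentialSeries

section SchurTest

open Matrix

variable {m n : Type*} [Fintype m] [Fintype n]

/- Schur's test: Cauchy-Schwarz on pairs of indices, each weighted by the matrix entry. -/
theorem sq_dotProduct_mulVec_le {A : Matrix m n ℝ} (hA : ∀ i j, 0 ≤ A i j) {a b : ℝ}
    (hrow : ∀ i, ∑ j, A i j ≤ a) (hcol : ∀ j, ∑ i, A i j ≤ b) (x : m → ℝ) (y : n → ℝ) :
    (x ⬝ᵥ A *ᵥ y) ^ 2 ≤ (a * (x ⬝ᵥ x)) * (b * (y ⬝ᵥ y)) := by
  have hform : x ⬝ᵥ A *ᵥ y = ∑ p : m × n, x p.1 * (A p.1 p.2 * y p.2) := by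
    simp only [dotProduct, mulVec, Finset.mul_sum, Fintype.sum_prod_type]
  have hx : ∑ p : m × n, A p.1 p.2 * (x p.1 * x p.1) ≤ a * (x ⬝ᵥ x) := by
    simp only [Fintype.sum_prod_type, dotProduct, Finset.mul_sum, ← Finset.sum_mul]
    exact Finset.sum_le_sum fun i _ => mul_le_mul_of_nonneg_right (hrow i) (mul_self_nonneg _)
  have hy : ∑ p : m × n, A p.1 p.2 * (y p.2 * y p.2) ≤ b * (y ⬝ᵥ y) := by
    simp only [Fintype.sum_prod_type_right, dotProduct, Finset.mul_sum, ← Finset.sum_mul]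
    exact Finset.sum_le_sum fun j _ => mul_le_mul_of_nonneg_right (hcol j) (mul_self_nonneg _)
  have hx₀ (p : m × n) : 0 ≤ A p.1 p.2 * (x p.1 * x p.1) := mul_nonneg (hA _ _) (mul_self_nonneg _)
  have hy₀ (p : m × n) : 0 ≤ A p.1 p.2 * (y p.2 * y p.2) := mul_nonneg (hA _ _) (mul_self_nonneg _)
  rw [hform]
  refine (Finset.sum_sq_le_sum_mul_sum_of_sq_le_mul Finset.univ (fun p _ => hx₀ p)
    (fun p _ => hy₀ p) fun p _ => le_of_eq (by ring)).trans ?_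
  have hy_sum := Finset.sum_nonneg fun p (_ : p ∈ Finset.univ) => hy₀ p
  exact mul_le_mul hx hy hy_sum ((Finset.sum_nonneg fun p _ => hx₀ p).trans hx)

theorem abs_dotProduct_mulVec_self_le {A : Matrix n n ℝ} (hA : ∀ i j, 0 ≤ A i j) {a b c : ℝ}
    (hrow : ∀ i, ∑ j, A i j ≤ a) (hcol : ∀ j, ∑ i, A i j ≤ b) (hc : 0 ≤ c) (habc : a * b ≤ c ^ 2)
    (v : n → ℝ) : |v ⬝ᵥ A *ᵥ v| ≤ c * (v ⬝ᵥ v) := by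
  have hv : 0 ≤ v ⬝ᵥ v := Finset.sum_nonneg fun _ _ => mul_self_nonneg _
  refine abs_le_of_sq_le_sq ?_ (by positivity)
  calc (v ⬝ᵥ A *ᵥ v) ^ 2 ≤ (a * (v ⬝ᵥ v)) * (b * (v ⬝ᵥ v)) :=
        sq_dotProduct_mulVec_le hA hrow hcol v v
    _ = a * b * (v ⬝ᵥ v) ^ 2 := by ring
    _ ≤ c ^ 2 * (v ⬝ᵥ v) ^ 2 := by gcongr
    _ = (c * (v ⬝ᵥ v)) ^ 2 := by ring

end SchurTest

section Isolation

open Matrix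

variable {n : Type*} [DecidableEq n]

/-- The matrix `A` without the edges that touch `L`, so that the elements of `L` become isolated
points of the weighted graph described by `A`. -/
def isolate (A : Matrix n n ℝ) (L : Finset n) : Matrix n n ℝ :=
  of fun i j => if i ∈ L ∨ j ∈ L then 0 else A i j

theorem isolate_isSymm {A : Matrix n n ℝ} (hA : A.IsSymm) (L : Finset n) :
    (isolate A L).IsSymm := by
  ext i j
  simp only [isolate, transpose_apply, of_apply, hA.apply i j, or_comm]

theorem norm_smul_isolate_apply_le {A : Matrix n n ℝ} (hA : ∀ i j, 0 ≤ A i j) (L : Finset n)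
    (t : ℝ) (i j : n) : ‖(t • isolate A L) i j‖ ≤ (|t| • A) i j := by
  simp only [Matrix.smul_apply, isolate, of_apply, smul_eq_mul, norm_mul, Real.norm_eq_abs]
  split_ifs
  · simpa using mul_nonneg (abs_nonneg t) (hA i j)
  · rw [abs_of_nonneg (hA i j)]

variable [Fintype n] {A : Matrix n n ℝ} {L : Finset n} {d δ : ℝ}

theorem abs_dotProduct_sub_isolate_mulVec_le (hA : ∀ i j, 0 ≤ A i j) (hsymm : A.IsSymm)
    (hrow : ∀ i, ∑ j, A i j ≤ d) (hL : ∀ i, ∑ j ∈ L, A i j ≤ δ ^ 2 * d) (hδ : 0 ≤ δ)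
    (hd : 0 ≤ d) (v : n → ℝ) :
    |v ⬝ᵥ (A - isolate A L) *ᵥ v| ≤ 2 * δ * d * (v ⬝ᵥ v) := by
  set R : Matrix n n ℝ := of fun i j => if i ∈ L then A i j else 0 with hR
  set C : Matrix n n ℝ := of fun i j => if i ∉ L ∧ j ∈ L then A i j else 0 with hC
  have hsplit : A - isolate A L = R + C := by
    ext i j
    simp only [hR, hC, isolate, Matrix.sub_apply, Matrix.add_apply, of_apply]
    by_cases hi : i ∈ L <;> by_cases hj : j ∈ L <;> simp [hi, hj]
  have hL' (i : n) : ∑ j, (if j ∈ L then A i j else 0) ≤ δ ^ 2 * d := by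
    simpa only [Finset.sum_ite_mem, Finset.univ_inter] using hL i
  have hR_le : |v ⬝ᵥ R *ᵥ v| ≤ δ * d * (v ⬝ᵥ v) := by
    refine abs_dotProduct_mulVec_self_le (a := d) (b := δ ^ 2 * d) (fun i j => ?_) (fun i => ?_)
      (fun j => ?_) (by positivity) (by nlinarith) v
    · exact ite_nonneg (hA i j) le_rfl
    · refine (Finset.sum_le_sum fun j _ => ?_).trans (hrow i)
      by_cases hi : i ∈ L <;> simp [hR, hi, hA]
    · simpa only [hR, of_apply, hsymm.apply] using hL' j
  have hC_le : |v ⬝ᵥ C *ᵥ v| ≤ δ * d * (v ⬝ᵥ v) := by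
    refine abs_dotProduct_mulVec_self_le (a := δ ^ 2 * d) (b := d) (fun i j => ?_) (fun i => ?_)
      (fun j => ?_) (by positivity) (by nlinarith) v
    · exact ite_nonneg (hA i j) le_rfl
    · refine (Finset.sum_le_sum fun j _ => ?_).trans (hL' i)
      by_cases hj : j ∈ L <;> by_cases hi : i ∈ L <;> simp [hC, hi, hj, hA]
    · refine (Finset.sum_le_sum fun i _ => ?_).trans (hrow j)
      rw [hC, of_apply, hsymm.apply]
      split_ifs
      exacts [le_rfl, hA j i]
  rw [hsplit, add_mulVec, dotProduct_add]
  linarith [abs_add_le (v ⬝ᵥ R *ᵥ v) (v ⬝ᵥ C *ᵥ v)]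

theorem dotProduct_smul_add_diagonal_mulVec_le (hA : ∀ i j, 0 ≤ A i j) (hsymm : A.IsSymm)
    (hrow : ∀ i, ∑ j, A i j ≤ d) (hL : ∀ i, ∑ j ∈ L, A i j ≤ δ ^ 2 * d) (hδ : 0 ≤ δ) (hd : 0 ≤ d)
    {u : n → ℝ} {M : ℝ} (hM : 0 ≤ M) (hu : ∀ i ∉ L, u i ≤ M) (t : ℝ) (v : n → ℝ) :
    v ⬝ᵥ (t • A + diagonal u) *ᵥ v ≤
      v ⬝ᵥ (t • isolate A L + diagonal (fun i => if i ∈ L then u i else 0) +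
        (M + 2 * |t| * δ * d) • 1) *ᵥ v := by
  have hdiag (w : n → ℝ) : v ⬝ᵥ diagonal w *ᵥ v = ∑ i, w i * (v i * v i) :=
    Finset.sum_congr rfl fun i _ => by rw [mulVec_diagonal]; ring
  have hpot : v ⬝ᵥ diagonal u *ᵥ v ≤
      v ⬝ᵥ diagonal (fun i => if i ∈ L then u i else 0) *ᵥ v + M * (v ⬝ᵥ v) := by
    rw [hdiag, hdiag, dotProduct, Finset.mul_sum, ← Finset.sum_add_distrib]
    refine Finset.sum_le_sum fun i _ => ?_
    have hi : u i ≤ (if i ∈ L then u i else 0) + M := by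
      split_ifs with h
      · exact le_add_of_nonneg_right hM
      · simpa only [zero_add] using hu i h
    rw [← add_mul]
    exact mul_le_mul_of_nonneg_right hi (mul_self_nonneg _)
  have hedge : t * (v ⬝ᵥ (A - isolate A L) *ᵥ v) ≤ |t| * (2 * δ * d * (v ⬝ᵥ v)) :=
    calc _ ≤ |t| * |v ⬝ᵥ (A - isolate A L) *ᵥ v| := (le_abs_self _).trans_eq (abs_mul _ _)
      _ ≤ _ := by
        gcongr
        exact abs_dotProduct_sub_isolate_mulVec_le hA hsymm hrow hL hδ hd v
  simp only [add_mulVec, sub_mulVec, smul_mulVec, dotProduct_add, dotProduct_sub, dotProduct_smul,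
    one_mulVec, smul_eq_mul] at hedge ⊢
  linarith

theorem trace_exp_smul_isolate_add_diagonal_le (hA : ∀ i j, 0 ≤ A i j) (u : n → ℝ) (t : ℝ) :
    (NormedSpace.exp (t • isolate A L + diagonal fun i => if i ∈ L then u i else 0)).trace ≤
      (NormedSpace.exp (|t| • A)).trace + ∑ i, Real.exp (u i) := by
  have hXY : (t • isolate A L) * diagonal (fun i => if i ∈ L then u i else 0) = 0 := by
    ext i j
    by_cases hj : j ∈ L <;> simp [isolate, mul_diagonal, hj]
  have hYX : diagonal (fun i => if i ∈ L then u i else 0) * (t • isolate A L) = 0 := by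
    ext i j
    by_cases hi : i ∈ L <;> simp [isolate, diagonal_mul, hi]
  have htrace_isolate : (NormedSpace.exp (t • isolate A L)).trace ≤
      (NormedSpace.exp (|t| • A)).trace :=
    (le_abs_self _).trans (norm_trace_exp_le (norm_smul_isolate_apply_le hA L t))
  have hdiag : (NormedSpace.exp (diagonal fun i => if i ∈ L then u i else 0)).trace ≤
      ∑ i, Real.exp (u i) + Fintype.card n := by
    rw [exp_diagonal_real, trace_diagonal, Fintype.card_eq_sum_ones, Nat.cast_sum, Nat.cast_one,
      ← Finset.sum_add_distrib]
    refine Finset.sum_le_sum fun i _ => ?_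
    split_ifs
    · linarith
    · linarith [Real.exp_pos (u i), Real.exp_zero]
  rw [trace_exp_add_of_mul_eq_zero hXY hYX]
  linarith

theorem trace_exp_smul_add_diagonal_le (hA : ∀ i j, 0 ≤ A i j) (hsymm : A.IsSymm)
    (hrow : ∀ i, ∑ j, A i j ≤ d) (hL : ∀ i, ∑ j ∈ L, A i j ≤ δ ^ 2 * d) (hδ : 0 ≤ δ) (hd : 0 ≤ d)
    {u : n → ℝ} {M : ℝ} (hM : 0 ≤ M) (hu : ∀ i ∉ L, u i ≤ M) (t : ℝ) :
    (NormedSpace.exp (t • A + diagonal u)).trace ≤ Real.exp (M + 2 * |t| * δ * d) *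
      ((NormedSpace.exp (|t| • A)).trace + ∑ i, Real.exp (u i)) := by
  have hherm {S : Matrix n n ℝ} (hS : S.IsSymm) (w : n → ℝ) : (t • S + diagonal w).IsHermitian :=
    (hS.smul t).add (isSymm_diagonal w)
  refine (trace_exp_mono (hherm hsymm u) ((hherm (isolate_isSymm hsymm L) _).add
    (isHermitian_one.smul (IsSelfAdjoint.all _)))
    (dotProduct_smul_add_diagonal_mulVec_le hA hsymm hrow hL hδ hd hM hu t)).trans ?_
  rw [RCLike.re_to_real, trace_exp_add_smul_one]
  gcongr
  exact trace_exp_smul_isolate_add_diagonal_le hA u t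

end Isolation

section Hypercube

open Matrix

variable {N : ℕ}

theorem flip_involutive (j : Fin N) : Function.Involutive (flip j) := fun σ => by
  simp [flip]

theorem flip_ne_self (j : Fin N) (σ : Config N) : flip j σ ≠ σ := by
  intro h
  simpa [flip] using congrFun h j

theorem flip_left_injective (σ : Config N) : Function.Injective fun j => flip j σ := by
  intro i j hij
  by_contra hne
  simpa [flip, Function.update_of_ne hne] using congrFun hij i

/-- The adjacency matrix of the hypercube, which is `-T` for the transversal field `T`, with real
entries. -/
def adjacency (N : ℕ) : Matrix (Config N) (Config N) ℝ :=
  of fun σ τ => ∑ j : Fin N, if τ = flip j σ then 1 else 0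

theorem adjacency_apply (σ τ : Config N) :
    adjacency N σ τ = ∑ j : Fin N, if τ = flip j σ then 1 else 0 := rfl

theorem adjacency_nonneg (σ τ : Config N) : 0 ≤ adjacency N σ τ := by
  rw [adjacency_apply]
  exact Finset.sum_nonneg fun _ _ => ite_nonneg zero_le_one le_rfl

theorem adjacency_isSymm (N : ℕ) : (adjacency N).IsSymm := by
  ext σ τ
  rw [transpose_apply, adjacency_apply, adjacency_apply]
  exact Finset.sum_congr rfl fun j _ =>
    if_congr (eq_comm.trans (flip_involutive j).eq_iff) rfl rfl

theorem adjacency_apply_self (σ : Config N) : adjacency N σ σ = 0 := by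
  rw [adjacency_apply]
  exact Finset.sum_eq_zero fun j _ => if_neg (flip_ne_self j σ).symm

theorem adjacency_mulVec (f : Config N → ℝ) (σ : Config N) :
    (adjacency N *ᵥ f) σ = ∑ j, f (flip j σ) := by
  simp only [mulVec, dotProduct, adjacency, of_apply, Finset.sum_mul]
  rw [Finset.sum_comm]
  simp

theorem sum_adjacency (σ : Config N) (L : Finset (Config N)) :
    ∑ τ ∈ L, adjacency N σ τ = (Finset.univ.filter fun j => flip j σ ∈ L).card := by
  have h := adjacency_mulVec (fun τ => if τ ∈ L then 1 else 0) σ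
  simpa [mulVec, dotProduct] using h

theorem sum_prod_config (f : Fin N → ℤˣ → ℝ) :
    ∑ σ : Config N, ∏ j, f j (σ j) = ∏ j, (f j 1 + f j (-1)) := by
  rw [← Fintype.prod_sum]
  exact Finset.prod_congr rfl fun j _ => by rw [UnitsInt.univ, Finset.sum_pair (by decide)]

/-- The character of the group `{-1, 1}^N` attached to the set of those `j` with `τ j = -1`, that
is, the product of the signs `σ j` over this set. -/
noncomputable def character (τ σ : Config N) : ℝ :=
  ∏ j, if τ j = 1 then 1 else ((σ j : ℤ) : ℝ)

theorem character_flip (τ σ : Config N) (j : Fin N) :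
    character τ (flip j σ) = ((τ j : ℤ) : ℝ) * character τ σ := by
  simp only [character]
  rw [← Finset.mul_prod_erase _ _ (Finset.mem_univ j),
    ← Finset.mul_prod_erase Finset.univ (fun j => if τ j = 1 then (1 : ℝ) else ((σ j : ℤ) : ℝ))
      (Finset.mem_univ j), ← mul_assoc]
  congr 1
  · rcases Int.units_eq_one_or (τ j) with h | h <;> simp [h, flip]
  · refine Finset.prod_congr rfl fun i hi => ?_
    rw [flip, Function.update_of_ne (Finset.ne_of_mem_erase hi)]

theorem character_mul_self (τ σ : Config N) : character τ σ * character τ σ = 1 := by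
  rw [character, ← Finset.prod_mul_distrib]
  refine Finset.prod_eq_one fun j _ => ?_
  rcases Int.units_eq_one_or (σ j) with h | h <;> split_ifs <;> simp [h]

theorem sum_character_mul_character (τ τ' : Config N) :
    ∑ σ, character τ σ * character τ' σ = if τ = τ' then (2 : ℝ) ^ N else 0 := by
  split_ifs with h
  · subst h
    simp [character_mul_self, Fintype.card_pi]
  · obtain ⟨j, hj⟩ := Function.ne_iff.1 h
    simp only [character, ← Finset.prod_mul_distrib]
    rw [sum_prod_config fun j u => (if τ j = 1 then (1 : ℝ) else ((u : ℤ) : ℝ)) *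
      (if τ' j = 1 then (1 : ℝ) else ((u : ℤ) : ℝ))]
    refine Finset.prod_eq_zero (Finset.mem_univ j) ?_
    rcases Int.units_eq_one_or (τ j) with h | h <;>
      rcases Int.units_eq_one_or (τ' j) with h' | h' <;> simp_all

/-- The normalized character table, whose columns are an orthonormal eigenbasis of the adjacency
matrix of the hypercube. -/
noncomputable def characterTable (N : ℕ) : Matrix (Config N) (Config N) ℝ :=
  of fun σ τ => (Real.sqrt (2 ^ N))⁻¹ * character τ σ

theorem characterTable_mul_characterTable (σ τ τ' : Config N) :
    characterTable N σ τ * characterTable N σ τ' =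
      ((2 : ℝ) ^ N)⁻¹ * (character τ σ * character τ' σ) := by
  rw [characterTable, of_apply, of_apply, mul_mul_mul_comm, ← mul_inv,
    Real.mul_self_sqrt (by positivity)]

theorem characterTable_mem_unitaryGroup (N : ℕ) :
    characterTable N ∈ unitaryGroup (Config N) ℝ := by
  rw [mem_unitaryGroup_iff']
  ext τ τ'
  simp only [mul_apply, star_apply, star_trivial, characterTable_mul_characterTable,
    ← Finset.mul_sum, sum_character_mul_character, one_apply]
  split_ifs <;> simp

/-- The sum of the signs, which are the eigenvalues of the adjacency matrix of the hypercube. -/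
def magnetization (τ : Config N) : ℝ := ∑ j, ((τ j : ℤ) : ℝ)

theorem adjacency_mul_characterTable (N : ℕ) :
    adjacency N * characterTable N = characterTable N * diagonal magnetization := by
  ext σ τ
  rw [mul_diagonal]
  refine (adjacency_mulVec (fun ρ => characterTable N ρ τ) σ).trans ?_
  simp only [characterTable, of_apply, character_flip, magnetization, Finset.mul_sum]
  exact Finset.sum_congr rfl fun j _ => by ring

theorem sum_exp_mul_magnetization (N : ℕ) (t : ℝ) :
    ∑ τ : Config N, Real.exp (t * magnetization τ) = (2 * Real.cosh t) ^ N := by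
  simp only [magnetization, Finset.mul_sum, Real.exp_sum]
  rw [sum_prod_config fun _ u => Real.exp (t * ((u : ℤ) : ℝ)), Finset.prod_const,
    Finset.card_univ, Fintype.card_fin, Real.cosh_eq]
  simp [mul_div_cancel₀]

theorem trace_exp_smul_adjacency (N : ℕ) (t : ℝ) :
    (NormedSpace.exp (t • adjacency N)).trace = (2 * Real.cosh t) ^ N := by
  have hU := characterTable_mem_unitaryGroup N
  have hdiag : adjacency N =
      characterTable N * diagonal magnetization * star (characterTable N) := by
    rw [← adjacency_mul_characterTable, mul_assoc, Unitary.mul_star_self_of_mem hU, mul_one]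
  have hsmul : t • adjacency N =
      characterTable N * diagonal (fun τ => t * magnetization τ) * star (characterTable N) := by
    rw [hdiag, ← Matrix.smul_mul, ← Matrix.mul_smul, ← diagonal_smul]
    rfl
  rw [hsmul, ← sum_exp_mul_magnetization]
  exact trace_exp_unitary_conj_diagonal ⟨_, hU⟩ _

end Hypercube

section PartitionFunction

open Matrix

open scoped Matrix.Norms.Operator in
theorem exp_map_ofReal {n : Type*} [Fintype n] [DecidableEq n] (A : Matrix n n ℝ) :
    NormedSpace.exp (A.map Complex.ofReal) = (NormedSpace.exp A).map Complex.ofReal :=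
  (NormedSpace.map_exp Complex.ofRealHom.mapMatrix
    (continuous_id.matrix_map Complex.continuous_ofReal) A).symm

variable {N : ℕ}

/-- The matrix `-β H`, with real entries. -/
noncomputable def gibbsExponent (β Γ : ℝ) (g : Config N → ℝ) : Matrix (Config N) (Config N) ℝ :=
  (β * Γ) • adjacency N + diagonal fun σ => -(β * potential g σ)

theorem gibbsExponent_isHermitian (β Γ : ℝ) (g : Config N → ℝ) :
    (gibbsExponent β Γ g).IsHermitian :=
  ((adjacency_isSymm N).smul (β * Γ)).add (isSymm_diagonal _)

theorem neg_smul_hamiltonian (β Γ : ℝ) (g : Config N → ℝ) :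
    -(β : ℂ) • hamiltonian Γ g = (gibbsExponent β Γ g).map Complex.ofReal := by
  ext σ τ
  have hT : transverseField N σ τ = -(adjacency N σ τ : ℂ) := by
    simp [transverseField, adjacency]
  simp only [hamiltonian, gibbsExponent, Matrix.smul_apply, Matrix.add_apply, hT,
    diagonal_apply, map_apply, smul_eq_mul]
  split_ifs <;> push_cast <;> ring

theorem partitionFunction_eq_trace_exp (β Γ : ℝ) (g : Config N → ℝ) :
    partitionFunction β Γ g =
      ((2 : ℝ) ^ N)⁻¹ * (NormedSpace.exp (gibbsExponent β Γ g)).trace := by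
  rw [partitionFunction, neg_smul_hamiltonian, exp_map_ofReal]
  simp [trace]

/-- The partition function of the random energy model, that is, without transversal field. -/
noncomputable def remPartition (β : ℝ) (g : Config N → ℝ) : ℝ :=
  ((2 : ℝ) ^ N)⁻¹ * ∑ σ, Real.exp (-(β * potential g σ))

theorem remPartition_pos (β : ℝ) (g : Config N → ℝ) : 0 < remPartition β g :=
  mul_pos (by positivity) (Finset.sum_pos (fun _ _ => Real.exp_pos _) Finset.univ_nonempty)

theorem remPartition_le_partitionFunction (β Γ : ℝ) (g : Config N → ℝ) :
    remPartition β g ≤ partitionFunction β Γ g := by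
  rw [remPartition, partitionFunction_eq_trace_exp]
  gcongr
  simpa [gibbsExponent, adjacency_apply_self] using
    sum_exp_diag_le_trace_exp (gibbsExponent_isHermitian β Γ g)

/-- The average of the potential over all configurations. -/
noncomputable def averagePotential (g : Config N → ℝ) : ℝ :=
  ((2 : ℝ) ^ N)⁻¹ * ∑ σ, potential g σ

theorem conj_gibbsExponent_apply_self (β Γ : ℝ) (g : Config N → ℝ) (τ : Config N) :
    (star (characterTable N) * gibbsExponent β Γ g * characterTable N) τ τ =
      β * Γ * magnetization τ - β * averagePotential g := by
  have hU := Unitary.star_mul_self_of_mem (characterTable_mem_unitaryGroup N)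
  rw [gibbsExponent, mul_add, add_mul, Matrix.add_apply, sub_eq_add_neg]
  congr 1
  · rw [Matrix.mul_smul, Matrix.smul_mul, mul_assoc, adjacency_mul_characterTable, ← mul_assoc,
      hU, one_mul, Matrix.smul_apply, diagonal_apply_eq, smul_eq_mul]
  · have hterm (σ : Config N) : star (characterTable N) τ σ * -(β * potential g σ) *
        characterTable N σ τ = -(β * (((2 : ℝ) ^ N)⁻¹ * potential g σ)) := by
      rw [star_apply, star_trivial, mul_right_comm, characterTable_mul_characterTable,
        character_mul_self]
      ring
    rw [mul_apply]
    simp only [mul_diagonal, hterm, averagePotential, Finset.mul_sum, Finset.sum_neg_distrib]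

theorem cosh_pow_mul_exp_le_partitionFunction (β Γ : ℝ) (g : Config N → ℝ) :
    Real.cosh (β * Γ) ^ N * Real.exp (-(β * averagePotential g)) ≤ partitionFunction β Γ g := by
  have hpeierls := sum_exp_diag_conj_le_trace_exp (gibbsExponent_isHermitian β Γ g)
    ⟨_, characterTable_mem_unitaryGroup N⟩
  simp only [conj_gibbsExponent_apply_self, RCLike.re_to_real, sub_eq_add_neg, Real.exp_add,
    ← Finset.sum_mul, sum_exp_mul_magnetization, mul_pow] at hpeierls
  rw [partitionFunction_eq_trace_exp, le_inv_mul_iff₀ (by positivity), ← mul_assoc]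
  exact hpeierls

theorem partitionFunction_le {β ε δ : ℝ} (Γ : ℝ) (hβ : 0 ≤ β) (hε : 0 ≤ ε) (hδ : 0 ≤ δ)
    {g : Config N → ℝ}
    (hg : ∀ σ, ((Finset.univ.filter fun j => potential g (flip j σ) < -(ε * N)).card : ℝ) ≤
      δ ^ 2 * N) :
    partitionFunction β Γ g ≤ Real.exp (N * (β * ε + 2 * |β * Γ| * δ)) *
      (Real.cosh (β * Γ) ^ N + remPartition β g) := by
  have hrow (σ : Config N) : ∑ τ, adjacency N σ τ ≤ N := by
    simp [sum_adjacency σ Finset.univ]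
  have hdeep (σ : Config N) :
      ∑ τ ∈ Finset.univ.filter (fun τ => potential g τ < -(ε * N)), adjacency N σ τ ≤
        δ ^ 2 * N := by
    simpa only [sum_adjacency, Finset.mem_filter_univ] using hg σ
  have hshallow (σ : Config N) (hσ : σ ∉ Finset.univ.filter fun τ => potential g τ < -(ε * N)) :
      -(β * potential g σ) ≤ β * (ε * N) := by
    rw [Finset.mem_filter_univ, not_lt] at hσ
    nlinarith
  have htrace := trace_exp_smul_add_diagonal_le adjacency_nonneg (adjacency_isSymm N) hrow hdeep
    hδ N.cast_nonneg (by positivity) hshallow (β * Γ)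
  rw [trace_exp_smul_adjacency, Real.cosh_abs, mul_pow] at htrace
  rw [partitionFunction_eq_trace_exp, remPartition, inv_mul_le_iff₀ (by positivity)]
  refine htrace.trans_eq ?_
  rw [show β * (ε * N) + 2 * |β * Γ| * δ * N = N * (β * ε + 2 * |β * Γ| * δ) by ring]
  field_simp

end PartitionFunction

section Probability

variable {Ω E ι : Type*} [MeasurableSpace Ω] [MeasurableSpace E] {P : Measure Ω}

theorem ae_eventually_notMem_of_summable [IsFiniteMeasure P] {s : ℕ → Set Ω} {b : ℕ → ℝ}
    (hb : Summable b) (h : ∀ᶠ n in atTop, P.real (s n) ≤ b n) :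
    ∀ᵐ ω ∂P, ∀ᶠ n in atTop, ω ∉ s n := by
  refine ae_eventually_notMem ?_
  have hsum : Summable fun n => P.real (s n) :=
    hb.of_norm_bounded_eventually_nat <| h.mono fun n hn => by
      rwa [Real.norm_of_nonneg measureReal_nonneg]
  simpa only [ofReal_measureReal, ne_eq, measure_ne_top, not_false_eq_true] using
    hsum.tsum_ofReal_ne_top

theorem measureReal_le_abs_sum_sub_integral_le [IsFiniteMeasure P] [Fintype ι] {Y : ι → Ω → ℝ}
    (hY : ∀ i, MemLp (Y i) 2 P) (hindep : Pairwise fun i j => IndepFun (Y i) (Y j) P)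
    {c : ℝ} (hc : 0 < c) :
    P.real {ω | c ≤ |∑ i, Y i ω - ∑ i, ∫ ω, Y i ω ∂P|} ≤ (∑ i, variance (Y i) P) / c ^ 2 := by
  have h := meas_ge_le_variance_div_sq (memLp_finsetSum' Finset.univ fun i _ => hY i) hc
  rw [IndepFun.variance_sum (fun i _ => hY i) fun i _ j _ hij => hindep hij] at h
  simp only [Finset.sum_apply,
    integral_finsetSum Finset.univ fun i _ => (hY i).integrable one_le_two] at h
  exact ENNReal.toReal_le_of_le_ofReal
    (div_nonneg (Finset.sum_nonneg fun i _ => variance_nonneg _ _) (sq_nonneg c)) h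

theorem integral_indicator_one_comp {X : Ω → E} (hX : AEMeasurable X P) {B : Set E}
    (hB : MeasurableSet B) :
    ∫ ω, B.indicator 1 (X ω) ∂P = P.real (X ⁻¹' B) := by
  rw [← integral_map hX (f := B.indicator (1 : E → ℝ))
    (measurable_one.indicator hB).aestronglyMeasurable, integral_indicator_one hB,
    map_measureReal_apply_of_aemeasurable hX hB]

theorem variance_indicator_one_comp_le [IsProbabilityMeasure P] {X : Ω → E}
    (hX : AEMeasurable X P) {B : Set E} (hB : MeasurableSet B) :
    variance (fun ω => B.indicator (1 : E → ℝ) (X ω)) P ≤ P.real (X ⁻¹' B) := by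
  have hmeas : AEMeasurable (fun ω => B.indicator (1 : E → ℝ) (X ω)) P :=
    (measurable_one.indicator hB).comp_aemeasurable hX
  refine (variance_le_expectation_sq hmeas.aestronglyMeasurable).trans_eq ?_
  rw [← integral_indicator_one_comp hX hB]
  congr with ω
  by_cases h : X ω ∈ B <;> simp [h]

theorem memLp_indicator_one_comp [IsFiniteMeasure P] {X : Ω → E} (hX : AEMeasurable X P)
    {B : Set E} (hB : MeasurableSet B) (p : ENNReal) :
    MemLp (fun ω => B.indicator (1 : E → ℝ) (X ω)) p P := by
  refine .of_bound
    ((measurable_one.indicator hB).comp_aemeasurable hX).aestronglyMeasurable 1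
    (.of_forall fun ω => ?_)
  by_cases h : X ω ∈ B <;> simp [h]

theorem measureReal_sum_indicator_le_half [IsProbabilityMeasure P] [Fintype ι] {X : ι → Ω → E}
    (hX : ∀ i, AEMeasurable (X i) P) (hindep : Pairwise fun i j => IndepFun (X i) (X j) P)
    {B : Set E} (hB : MeasurableSet B) {m : ℝ} (hm : 0 < m)
    (hmean : m ≤ ∑ i, P.real (X i ⁻¹' B)) :
    P.real {ω | ∑ i, B.indicator 1 (X i ω) ≤ m / 2} ≤ 4 / m := by
  have hB1 : Measurable (B.indicator (1 : E → ℝ)) := measurable_one.indicator hB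
  set M := ∑ i, P.real (X i ⁻¹' B) with hM
  have hM0 : 0 < M := hm.trans_le hmean
  have hcheb := measureReal_le_abs_sum_sub_integral_le
    (fun i => memLp_indicator_one_comp (hX i) hB 2)
    (fun i j hij => (hindep hij).comp hB1 hB1) (half_pos hM0)
  simp only [integral_indicator_one_comp (hX _) hB, ← hM] at hcheb
  calc P.real {ω | ∑ i, B.indicator 1 (X i ω) ≤ m / 2}
      ≤ P.real {ω | M / 2 ≤ |∑ i, B.indicator 1 (X i ω) - M|} := by
        refine measureReal_mono fun ω hω => ?_
        rw [Set.mem_ofPred_eq] at hω ⊢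
        exact le_abs.2 (.inr (by linarith))
    _ ≤ (∑ i, variance (fun ω => B.indicator (1 : E → ℝ) (X i ω)) P) / (M / 2) ^ 2 := hcheb
    _ ≤ M / (M / 2) ^ 2 := by
        gcongr
        exact Finset.sum_le_sum fun i _ => variance_indicator_one_comp_le (hX i) hB
    _ = 4 / M := by
        field_simp
        norm_num
    _ ≤ 4 / m := by gcongr

theorem mgf_indicator_one_comp_le_two [IsProbabilityMeasure P] {X : Ω → E}
    (hX : AEMeasurable X P) {B : Set E} (hB : MeasurableSet B) {a : ℝ}
    (hp : P.real (X ⁻¹' B) ≤ Real.exp (-a)) :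
    mgf (fun ω => B.indicator (1 : E → ℝ) (X ω)) P a ≤ 2 := by
  have hexp (ω : Ω) : Real.exp (a * B.indicator (1 : E → ℝ) (X ω)) =
      1 + (Real.exp a - 1) * B.indicator 1 (X ω) := by
    by_cases h : X ω ∈ B <;> simp [h]
  have hint := (memLp_indicator_one_comp hX hB 1).integrable le_rfl
  simp only [mgf, hexp]
  rw [integral_add (integrable_const 1) (hint.const_mul _), integral_const_mul,
    integral_indicator_one_comp hX hB]
  have hscale : Real.exp a * P.real (X ⁻¹' B) ≤ 1 := by
    rwa [Real.exp_neg, ← one_div, le_div_iff₀' (Real.exp_pos a)] at hp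
  have hnonneg := measureReal_nonneg (μ := P) (s := X ⁻¹' B)
  rw [integral_const, probReal_univ, one_smul]
  linarith

theorem measureReal_le_sum_indicator_le [Fintype ι] {X : ι → Ω → E}
    (hX : ∀ i, AEMeasurable (X i) P) (hindep : iIndepFun X P) {B : Set E} (hB : MeasurableSet B)
    {a : ℝ} (ha : 0 ≤ a) (hp : ∀ i, P.real (X i ⁻¹' B) ≤ Real.exp (-a)) (t : ℝ) :
    P.real {ω | t ≤ ∑ i, B.indicator 1 (X i ω)} ≤ 2 ^ Fintype.card ι * Real.exp (-(a * t)) := by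
  have := hindep.isProbabilityMeasure
  have hB1 : Measurable (B.indicator (1 : E → ℝ)) := measurable_one.indicator hB
  set Y : ι → Ω → ℝ := fun i => B.indicator 1 ∘ X i with hY
  have hYm (i : ι) : AEMeasurable (Y i) P := hB1.comp_aemeasurable (hX i)
  have hmgf : mgf (∑ i, Y i) P a ≤ 2 ^ Fintype.card ι := by
    rw [(hindep.comp _ fun _ => hB1).mgf_sum₀ hYm]
    exact (Finset.prod_le_prod (fun _ _ => mgf_nonneg) fun i _ =>
      mgf_indicator_one_comp_le_two (hX i) hB (hp i)).trans_eq (Finset.prod_const 2)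
  have hint : Integrable (fun ω => Real.exp (a * (∑ i, Y i) ω)) P := by
    refine integrable_exp_mul_of_mem_Icc (a := 0) (b := ∑ _ : ι, 1)
      (Finset.aemeasurable_sum _ fun i _ => hYm i) (.of_forall fun ω => ?_)
    rw [Finset.sum_apply]
    exact ⟨Finset.sum_nonneg fun _ _ => Set.indicator_nonneg (fun _ _ => zero_le_one) _,
      Finset.sum_le_sum fun _ _ => Set.indicator_le_self' (fun _ _ => zero_le_one) _⟩
  have hchernoff := measure_ge_le_exp_mul_mgf t ha hint
  simp only [Finset.sum_apply, hY, Function.comp_apply] at hchernoff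
  rw [neg_mul] at hchernoff
  refine hchernoff.trans ?_
  rw [mul_comm]
  gcongr

end Probability

section Gaussian

theorem gaussianReal_Iic_neg_le (v : NNReal) {y : ℝ} (hy : 0 ≤ y) :
    (gaussianReal 0 v).real (Set.Iic (-y)) ≤ Real.exp (-(y ^ 2 / (2 * v))) := by
  have h := measure_le_le_exp_mul_mgf (X := id) (μ := gaussianReal 0 v) (t := -(y / v)) (-y)
    (neg_nonpos.2 (by positivity)) (integrable_exp_mul_gaussianReal _)
  refine h.trans_eq ?_
  rw [mgf_id_gaussianReal, ← Real.exp_add]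
  rcases eq_or_ne v 0 with rfl | _
  · simp
  · field_simp
    ring_nf

theorem le_gaussianReal_Iic_neg (v : NNReal) {y : ℝ} (hy : 0 ≤ y) :
    (Real.sqrt (2 * Real.pi * v))⁻¹ * Real.exp (-((y + 1) ^ 2 / (2 * v))) ≤
      (gaussianReal 0 v).real (Set.Iic (-y)) := by
  rcases eq_or_ne v 0 with rfl | hv
  · simp
  set c := (Real.sqrt (2 * Real.pi * v))⁻¹ * Real.exp (-((y + 1) ^ 2 / (2 * v))) with hc
  have hpdf (x : ℝ) (hx : x ∈ Set.Icc (-y - 1) (-y)) : c ≤ gaussianPDFReal 0 v x := by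
    rw [gaussianPDFReal, sub_zero, neg_div, hc]
    gcongr ?_ * Real.exp (-(?_ / _))
    exact sq_le_sq' (by linarith [hx.1]) (by linarith [hx.2])
  calc c = ∫ _ in Set.Icc (-y - 1) (-y), c := by simp
    _ ≤ ∫ x in Set.Icc (-y - 1) (-y), gaussianPDFReal 0 v x :=
        setIntegral_mono_on (by simp) (integrable_gaussianPDFReal 0 v).integrableOn
          measurableSet_Icc hpdf
    _ = (gaussianReal 0 v).real (Set.Icc (-y - 1) (-y)) := by
        rw [Measure.real, gaussianReal_apply_eq_integral 0 hv, ENNReal.toReal_ofReal]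
        exact integral_nonneg (gaussianPDFReal_nonneg 0 v)
    _ ≤ (gaussianReal 0 v).real (Set.Iic (-y)) := measureReal_mono Set.Icc_subset_Iic_self

end Gaussian

section RandomEnergyModel

theorem betaC_pos : 0 < betaC :=
  Real.sqrt_pos.2 (mul_pos two_pos (Real.log_pos one_lt_two))

theorem betaC_sq : betaC ^ 2 = 2 * Real.log 2 :=
  Real.sq_sqrt (mul_pos two_pos (Real.log_pos one_lt_two)).le

theorem two_pow_eq_exp (N : ℕ) : (2 : ℝ) ^ N = Real.exp (N * Real.log 2) := by
  rw [Real.exp_nat_mul, Real.exp_log two_pos]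

theorem sum_rpow_le_rpow_sum {ι : Type*} (s : Finset ι) {x : ι → ℝ} (hx : ∀ i ∈ s, 0 ≤ x i)
    {r : ℝ} (hr : 1 ≤ r) : ∑ i ∈ s, x i ^ r ≤ (∑ i ∈ s, x i) ^ r := by
  have hr0 : r ≠ 0 := (one_pos.trans_le hr).ne'
  classical
  induction s using Finset.induction_on with
  | empty => simp [Real.zero_rpow hr0]
  | insert i s hi ih =>
    rw [Finset.sum_insert hi, Finset.sum_insert hi]
    rw [Finset.forall_mem_insert] at hx
    exact (add_le_add_right (ih hx.2) _).trans
      (Real.add_rpow_le_rpow_add hx.1 (Finset.sum_nonneg hx.2) hr)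

variable {N : ℕ}

theorem remPartition_le_of_critical {β η : ℝ} (hβ : betaC ≤ β) {g : Config N → ℝ}
    (h : remPartition betaC g ≤ Real.exp (N * (betaC ^ 2 / 2 + η))) :
    remPartition β g ≤ Real.exp (N * (betaC ^ 2 / 2 + (β - betaC) * betaC + β / betaC * η)) := by
  have hc := betaC_pos
  have hpow : (2 : ℝ) ^ N = Real.exp (N * (betaC ^ 2 / 2)) := by
    rw [two_pow_eq_exp, betaC_sq, mul_div_cancel_left₀ _ two_ne_zero]
  rw [remPartition, inv_mul_le_iff₀ (by positivity), hpow, ← Real.exp_add] at h ⊢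
  calc ∑ σ, Real.exp (-(β * potential g σ))
      = ∑ σ, Real.exp (-(betaC * potential g σ)) ^ (β / betaC) := by
        refine Finset.sum_congr rfl fun σ _ => ?_
        rw [← Real.exp_mul]
        field_simp
    _ ≤ (∑ σ, Real.exp (-(betaC * potential g σ))) ^ (β / betaC) :=
        sum_rpow_le_rpow_sum _ (fun _ _ => (Real.exp_pos _).le) ((one_le_div hc).2 hβ)
    _ ≤ Real.exp (N * (betaC ^ 2 / 2) + N * (betaC ^ 2 / 2 + η)) ^ (β / betaC) := by
        gcongr
        exact div_nonneg (hc.le.trans hβ) hc.le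
    _ = Real.exp (N * (betaC ^ 2 / 2) +
          N * (betaC ^ 2 / 2 + (β - betaC) * betaC + β / betaC * η)) := by
        rw [← Real.exp_mul]
        field_simp
        ring_nf

/-- The number of configurations of energy at most `-x N`, as a real number. -/
noncomputable def levelCount (x : ℝ) (g : Config N → ℝ) : ℝ :=
  ∑ σ, (Set.Iic (-(x * N))).indicator 1 (potential g σ)

theorem exp_mul_levelCount_le_remPartition {β : ℝ} (hβ : 0 ≤ β) (x : ℝ) (g : Config N → ℝ) :
    ((2 : ℝ) ^ N)⁻¹ * (Real.exp (N * (β * x)) * levelCount x g) ≤ remPartition β g := by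
  rw [remPartition, levelCount, Finset.mul_sum]
  gcongr with σ
  by_cases hσ : potential g σ ∈ Set.Iic (-(x * N))
  · rw [Set.indicator_of_mem hσ, Pi.one_apply, mul_one]
    rw [Set.mem_Iic] at hσ
    gcongr
    nlinarith
  · rw [Set.indicator_of_notMem hσ, mul_zero]
    exact (Real.exp_pos _).le

theorem eventually_mul_le_exp (C : ℝ) {η : ℝ} (hη : 0 < η) :
    ∀ᶠ N : ℕ in atTop, C * N ≤ Real.exp (N * η) := by
  have h := (isLittleO_pow_exp_pos_mul_atTop 1 hη).const_mul_left C
  filter_upwards [tendsto_natCast_atTop_atTop.eventually (h.def one_pos)] with N hN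
  simpa [mul_comm η] using (le_abs_self _).trans hN

theorem eventually_le_gaussianReal_Iic {x η : ℝ} (hx : 0 ≤ x) (hη : 0 < η) :
    ∀ᶠ N : ℕ in atTop, 4 * Real.exp (-(N * (x ^ 2 / 2 + η))) ≤
      (gaussianReal 0 N).real (Set.Iic (-(x * N))) := by
  filter_upwards [eventually_mul_le_exp (4 * Real.sqrt (2 * Real.pi) * Real.exp (x + 1 / 2)) hη,
    eventually_ge_atTop 1] with N hN hN1
  have hN1' : (1 : ℝ) ≤ N := by exact_mod_cast hN1
  have hsqrt : Real.sqrt (2 * Real.pi * N) ≤ Real.sqrt (2 * Real.pi) * N := by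
    rw [Real.sqrt_mul (by positivity)]
    gcongr
    exact Real.sqrt_le_iff.2 ⟨by positivity, by nlinarith⟩
  have hexponent : (x * N + 1) ^ 2 / (2 * N) ≤ N * (x ^ 2 / 2) + (x + 1 / 2) := by
    rw [div_le_iff₀ (by positivity)]
    nlinarith
  refine le_trans ?_ (le_gaussianReal_Iic_neg N (by positivity : 0 ≤ x * N))
  rw [NNReal.coe_natCast, le_inv_mul_iff₀ (Real.sqrt_pos.2 (by positivity))]
  calc Real.sqrt (2 * Real.pi * N) * (4 * Real.exp (-(N * (x ^ 2 / 2 + η))))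
      ≤ Real.sqrt (2 * Real.pi) * N * (4 * Real.exp (-(N * (x ^ 2 / 2 + η)))) := by gcongr
    _ = 4 * Real.sqrt (2 * Real.pi) * Real.exp (x + 1 / 2) * N *
          Real.exp (-(N * (x ^ 2 / 2 + η) + (x + 1 / 2))) := by
        rw [neg_add, Real.exp_add _ (-(x + 1 / 2)), Real.exp_neg (x + 1 / 2)]
        field_simp
    _ ≤ Real.exp (N * η) * Real.exp (-(N * (x ^ 2 / 2 + η) + (x + 1 / 2))) := by gcongr
    _ ≤ Real.exp (-((x * N + 1) ^ 2 / (2 * N))) := by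
        rw [← Real.exp_add]
        gcongr
        linarith

variable {Ω : Type*} [MeasurableSpace Ω] {P : Measure Ω} {g : Config N → Ω → ℝ}

theorem hasLaw_potential {σ : Config N} (hlaw : HasLaw (g σ) (gaussianReal 0 1) P) :
    HasLaw (fun ω => potential (g · ω) σ) (gaussianReal 0 N) P := by
  convert! gaussianReal_const_mul hlaw (Real.sqrt N) using 2
  · simp
  · ext
    simp

theorem iIndepFun_potential (hindep : iIndepFun g P) :
    iIndepFun (fun σ ω => potential (g · ω) σ) P :=
  hindep.comp (fun _ z => Real.sqrt N * z) fun _ => measurable_const_mul _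

theorem integrable_exp_potential [NeZero P] {σ : Config N}
    (hlaw : HasLaw (g σ) (gaussianReal 0 1) P) (β : ℝ) :
    Integrable (fun ω => Real.exp (-(β * potential (g · ω) σ))) P := by
  have h : 0 < mgf (fun ω => potential (g · ω) σ) P (-β) := by
    rw [mgf_gaussianReal (hasLaw_potential hlaw).map_eq]
    exact Real.exp_pos _
  simpa only [neg_mul] using mgf_pos_iff.1 h

theorem integral_remPartition (hlaw : ∀ σ, HasLaw (g σ) (gaussianReal 0 1) P) (β : ℝ) :
    ∫ ω, remPartition β (g · ω) ∂P = Real.exp (N * (β ^ 2 / 2)) := by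
  have := (hlaw 1).isProbabilityMeasure
  have hmgf (σ : Config N) : ∫ ω, Real.exp (-(β * potential (g · ω) σ)) ∂P =
      Real.exp (N * (β ^ 2 / 2)) := by
    have h := mgf_gaussianReal (hasLaw_potential (hlaw σ)).map_eq (-β)
    simp only [mgf, neg_mul] at h
    rw [h, NNReal.coe_natCast]
    ring_nf
  simp only [remPartition]
  rw [integral_const_mul, integral_finsetSum _ fun σ _ => integrable_exp_potential (hlaw σ) β]
  simp [hmgf]

theorem measureReal_le_remPartition_le (hlaw : ∀ σ, HasLaw (g σ) (gaussianReal 0 1) P)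
    (β η : ℝ) :
    P.real {ω | Real.exp (N * (β ^ 2 / 2 + η)) ≤ remPartition β (g · ω)} ≤
      Real.exp (N * -η) := by
  have := (hlaw 1).isProbabilityMeasure
  have hint : Integrable (fun ω => remPartition β (g · ω)) P :=
    (integrable_finsetSum _ fun σ _ => integrable_exp_potential (hlaw σ) β).const_mul _
  have hmarkov := mul_meas_ge_le_integral_of_nonneg
    (.of_forall fun ω => (remPartition_pos β (g · ω)).le) hint (Real.exp (N * (β ^ 2 / 2 + η)))
  rw [integral_remPartition hlaw, mul_comm, ← le_div_iff₀ (Real.exp_pos _), ← Real.exp_sub]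
    at hmarkov
  refine hmarkov.trans_eq ?_
  ring_nf

theorem measureReal_levelCount_le (hlaw : ∀ σ, HasLaw (g σ) (gaussianReal 0 1) P)
    (hindep : iIndepFun g P) {x η : ℝ}
    (htail : 4 * Real.exp (-(N * (x ^ 2 / 2 + η))) ≤
      (gaussianReal 0 N).real (Set.Iic (-(x * N)))) :
    P.real {ω | levelCount x (g · ω) ≤ 2 * Real.exp (N * (Real.log 2 - x ^ 2 / 2 - η))} ≤
      Real.exp (N * -(Real.log 2 - x ^ 2 / 2 - η)) := by
  have := hindep.isProbabilityMeasure
  have hmean : 4 * Real.exp (N * (Real.log 2 - x ^ 2 / 2 - η)) ≤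
      ∑ σ, P.real ((fun ω => potential (g · ω) σ) ⁻¹' Set.Iic (-(x * N))) := by
    calc 4 * Real.exp (N * (Real.log 2 - x ^ 2 / 2 - η))
        = 2 ^ N * (4 * Real.exp (-(N * (x ^ 2 / 2 + η)))) := by
          rw [two_pow_eq_exp, mul_left_comm, ← Real.exp_add]
          ring_nf
      _ ≤ 2 ^ N * (gaussianReal 0 N).real (Set.Iic (-(x * N))) := by gcongr
      _ = ∑ σ, P.real ((fun ω => potential (g · ω) σ) ⁻¹' Set.Iic (-(x * N))) := by
          have hprob (σ : Config N) :
              P.real ((fun ω => potential (g · ω) σ) ⁻¹' Set.Iic (-(x * N))) =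
                (gaussianReal 0 N).real (Set.Iic (-(x * N))) :=
            (hasLaw_potential (hlaw σ)).measureReal_eq (p := (· ∈ Set.Iic _)) measurableSet_Iic
          simp [hprob]
  calc P.real {ω | levelCount x (g · ω) ≤ 2 * Real.exp (N * (Real.log 2 - x ^ 2 / 2 - η))}
      = P.real {ω | levelCount x (g · ω) ≤
          4 * Real.exp (N * (Real.log 2 - x ^ 2 / 2 - η)) / 2} := by
        ring_nf
    _ ≤ 4 / (4 * Real.exp (N * (Real.log 2 - x ^ 2 / 2 - η))) :=
        measureReal_sum_indicator_le_half (fun σ => (hasLaw_potential (hlaw σ)).aemeasurable)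
          (fun σ τ h => (iIndepFun_potential hindep).indepFun h) measurableSet_Iic (by positivity)
          hmean
    _ = Real.exp (N * -(Real.log 2 - x ^ 2 / 2 - η)) := by
        rw [div_mul_cancel_left₀ four_ne_zero, ← Real.exp_neg, mul_neg]

theorem measureReal_le_abs_averagePotential_le (hlaw : ∀ σ, HasLaw (g σ) (gaussianReal 0 1) P)
    (hindep : iIndepFun g P) (hN : 1 ≤ N) {η : ℝ} (hη : 0 < η) :
    P.real {ω | N * η ≤ |averagePotential (g · ω)|} ≤ (η ^ 2)⁻¹ * (1 / 2) ^ N := by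
  have := hindep.isProbabilityMeasure
  have hN' : (1 : ℝ) ≤ N := by exact_mod_cast hN
  have hcheb := measureReal_le_abs_sum_sub_integral_le
    (fun σ => (hasLaw_potential (hlaw σ)).hasGaussianLaw.memLp_two)
    (fun σ τ h => (iIndepFun_potential hindep).indepFun h)
    (c := 2 ^ N * (N * η)) (by positivity)
  simp only [(hasLaw_potential (hlaw _)).integral_eq, (hasLaw_potential (hlaw _)).variance_eq,
    integral_id_gaussianReal, variance_id_gaussianReal, Finset.sum_const_zero, sub_zero,
    Finset.sum_const, Finset.card_univ, Fintype.card_pi, Fintype.card_units_int,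
    Finset.prod_const, Fintype.card_fin, nsmul_eq_mul, Nat.cast_pow, Nat.cast_ofNat,
    NNReal.coe_natCast] at hcheb
  simp only [averagePotential, abs_mul, abs_inv, abs_pow, Nat.abs_ofNat]
  simp only [le_inv_mul_iff₀ (by positivity : (0 : ℝ) < 2 ^ N)]
  refine hcheb.trans ?_
  rw [div_le_iff₀ (by positivity)]
  calc (2 : ℝ) ^ N * N ≤ 2 ^ N * N * N := le_mul_of_one_le_right (by positivity) hN'
    _ = (η ^ 2)⁻¹ * (1 / 2) ^ N * (2 ^ N * (N * η)) ^ 2 := by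
        rw [one_div, inv_pow]
        field_simp

theorem measureReal_exists_lt_card_le (hlaw : ∀ σ, HasLaw (g σ) (gaussianReal 0 1) P)
    (hindep : iIndepFun g P) {ε : ℝ} (hε : 0 ≤ ε) (t : ℝ) :
    P.real {ω | ∃ σ, t < (Finset.univ.filter fun j =>
        potential (g · ω) (flip j σ) < -(ε * N)).card} ≤
      2 ^ N * (2 ^ N * Real.exp (-(N * (ε ^ 2 / 2) * t))) := by
  have := hindep.isProbabilityMeasure
  have htail (σ : Config N) : P.real ((fun ω => potential (g · ω) σ) ⁻¹' Set.Iio (-(ε * N))) ≤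
      Real.exp (-(N * (ε ^ 2 / 2))) := by
    calc P.real ((fun ω => potential (g · ω) σ) ⁻¹' Set.Iio (-(ε * N)))
        = (gaussianReal 0 N).real (Set.Iio (-(ε * N))) :=
          (hasLaw_potential (hlaw σ)).measureReal_eq (p := (· ∈ Set.Iio _)) measurableSet_Iio
      _ ≤ (gaussianReal 0 N).real (Set.Iic (-(ε * N))) := measureReal_mono Set.Iio_subset_Iic_self
      _ ≤ Real.exp (-((ε * N) ^ 2 / (2 * N))) := by
          simpa using gaussianReal_Iic_neg_le N (by positivity : 0 ≤ ε * N)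
      _ = Real.exp (-(N * (ε ^ 2 / 2))) := by
          rcases eq_or_ne (N : ℝ) 0 with h | _
          · simp [h]
          · field_simp
  have hcount (σ : Config N) :
      P.real {ω | t < (Finset.univ.filter fun j =>
        potential (g · ω) (flip j σ) < -(ε * N)).card} ≤
      2 ^ N * Real.exp (-(N * (ε ^ 2 / 2) * t)) := by
    have h := measureReal_le_sum_indicator_le
      (fun j => (hasLaw_potential (hlaw (flip j σ))).aemeasurable)
      ((iIndepFun_potential hindep).precomp (flip_left_injective σ)) measurableSet_Iio
      (by positivity) (fun j => htail (flip j σ)) t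
    rw [Fintype.card_fin] at h
    refine (measureReal_mono fun ω hω => ?_).trans h
    simpa [Set.indicator_apply, Finset.sum_boole] using hω.le
  rw [Set.ofPred_exists]
  refine (measureReal_iUnion_fintype_le _).trans ?_
  refine (Finset.sum_le_sum fun σ _ => hcount σ).trans_eq ?_
  simp

end RandomEnergyModel

section Asymptotics

theorem pREM_eq (β : ℝ) : pREM β = β * min β betaC - min β betaC ^ 2 / 2 := by
  rw [pREM]
  split_ifs with h
  · rw [min_eq_left h]
    ring
  · rw [min_eq_right (not_le.1 h).le]
    ring

theorem exists_lt_betaC_pREM_sub_le {β η : ℝ} (hβ : 0 ≤ β) (hη : 0 < η) :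
    ∃ x, 0 ≤ x ∧ x < betaC ∧ pREM β - η ≤ β * x - x ^ 2 / 2 := by
  have hcont : Continuous fun y => β * min β y - min β y ^ 2 / 2 := by fun_prop
  have hnear : ∀ᶠ y in 𝓝[<] betaC, pREM β - η ≤ β * min β y - min β y ^ 2 / 2 := by
    refine ((hcont.tendsto betaC).mono_left nhdsWithin_le_nhds).eventually_const_le ?_
    rw [← pREM_eq]
    linarith
  obtain ⟨y, hy, hy0, hyc⟩ := (hnear.and (Ioo_mem_nhdsLT betaC_pos)).exists
  exact ⟨min β y, le_min hβ hy0.le, min_lt_of_right_lt hyc, hy⟩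

theorem summable_exp_mul_neg {c : ℝ} (hc : 0 < c) : Summable fun N : ℕ => Real.exp (N * -c) :=
  Real.summable_exp_nat_mul_iff.2 (neg_lt_zero.2 hc)

variable {Ω : Type*} [MeasurableSpace Ω] {P : Measure Ω} [IsProbabilityMeasure P]
  {g : (N : ℕ) → Config N → Ω → ℝ}

theorem eventually_remPartition_lt_annealed (hlaw : ∀ N σ, HasLaw (g N σ) (gaussianReal 0 1) P)
    (β : ℝ) {η : ℝ} (hη : 0 < η) :
    ∀ᵐ ω ∂P, ∀ᶠ N : ℕ in atTop,
      remPartition β (g N · ω) < Real.exp (N * (β ^ 2 / 2 + η)) := by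
  filter_upwards [ae_eventually_notMem_of_summable (summable_exp_mul_neg hη)
    (.of_forall fun N => measureReal_le_remPartition_le (hlaw N) β η)] with ω hω
  exact hω.mono fun N => not_le.1

theorem eventually_remPartition_le (hlaw : ∀ N σ, HasLaw (g N σ) (gaussianReal 0 1) P)
    (β : ℝ) {η : ℝ} (hη : 0 < η) :
    ∀ᵐ ω ∂P, ∀ᶠ N : ℕ in atTop, remPartition β (g N · ω) ≤ Real.exp (N * (pREM β + η)) := by
  rcases le_or_gt β betaC with hβ | hβ
  · filter_upwards [eventually_remPartition_lt_annealed hlaw β hη] with ω hω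
    rw [pREM, if_pos hβ]
    exact hω.mono fun N => le_of_lt
  · have hc := betaC_pos
    have hβ0 := hc.trans hβ
    filter_upwards [eventually_remPartition_lt_annealed hlaw betaC
      (η := betaC / β * η) (by positivity)] with ω hω
    filter_upwards [hω] with N hN
    refine (remPartition_le_of_critical hβ.le hN.le).trans_eq ?_
    rw [pREM, if_neg hβ.not_ge]
    field_simp

theorem eventually_exp_le_remPartition_of_level
    (hlaw : ∀ N σ, HasLaw (g N σ) (gaussianReal 0 1) P) (hindep : ∀ N, iIndepFun (g N) P)
    {β x η : ℝ} (hβ : 0 ≤ β) (hx : 0 ≤ x) (hη : 0 < η) (hη' : η < Real.log 2 - x ^ 2 / 2) :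
    ∀ᵐ ω ∂P, ∀ᶠ N : ℕ in atTop,
      Real.exp (N * (β * x - x ^ 2 / 2 - η)) ≤ remPartition β (g N · ω) := by
  filter_upwards [ae_eventually_notMem_of_summable (summable_exp_mul_neg (sub_pos.2 hη'))
    ((eventually_le_gaussianReal_Iic hx hη).mono fun N hN =>
      measureReal_levelCount_le (hlaw N) (hindep N) hN)] with ω hω
  filter_upwards [hω] with N hN
  have hcount : Real.exp (N * (Real.log 2 - x ^ 2 / 2 - η)) ≤ levelCount x (g N · ω) :=
    (le_mul_of_one_le_left (Real.exp_pos _).le one_le_two).trans (not_le.1 hN).le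
  refine le_trans ?_ (exp_mul_levelCount_le_remPartition hβ x _)
  calc Real.exp (N * (β * x - x ^ 2 / 2 - η))
      = (2 ^ N)⁻¹ * (Real.exp (N * (β * x)) * Real.exp (N * (Real.log 2 - x ^ 2 / 2 - η))) := by
        rw [two_pow_eq_exp, ← Real.exp_neg, ← Real.exp_add, ← Real.exp_add]
        ring_nf
    _ ≤ (2 ^ N)⁻¹ * (Real.exp (N * (β * x)) * levelCount x (g N · ω)) := by gcongr

theorem eventually_exp_le_remPartition (hlaw : ∀ N σ, HasLaw (g N σ) (gaussianReal 0 1) P)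
    (hindep : ∀ N, iIndepFun (g N) P) {β η : ℝ} (hβ : 0 ≤ β) (hη : 0 < η) :
    ∀ᵐ ω ∂P, ∀ᶠ N : ℕ in atTop, Real.exp (N * (pREM β - η)) ≤ remPartition β (g N · ω) := by
  obtain ⟨x, hx0, hxc, hx⟩ := exists_lt_betaC_pREM_sub_le hβ (half_pos hη)
  have hgap : 0 < Real.log 2 - x ^ 2 / 2 := by
    have := betaC_sq
    nlinarith
  obtain ⟨θ, hθ0, hθ⟩ := exists_between (lt_min (half_pos hη) hgap)
  rw [lt_min_iff] at hθ
  filter_upwards [eventually_exp_le_remPartition_of_level hlaw hindep hβ hx0 hθ0 hθ.2] with ω hω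
  filter_upwards [hω] with N hN
  refine le_trans ?_ hN
  gcongr Real.exp (N * ?_)
  linarith

theorem eventually_abs_averagePotential_le
    (hlaw : ∀ N σ, HasLaw (g N σ) (gaussianReal 0 1) P) (hindep : ∀ N, iIndepFun (g N) P)
    {η : ℝ} (hη : 0 < η) :
    ∀ᵐ ω ∂P, ∀ᶠ N : ℕ in atTop, |averagePotential (g N · ω)| ≤ N * η := by
  filter_upwards [ae_eventually_notMem_of_summable (summable_geometric_two.mul_left (η ^ 2)⁻¹)
    ((eventually_ge_atTop 1).mono fun N hN =>
      measureReal_le_abs_averagePotential_le (hlaw N) (hindep N) hN hη)] with ω hω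
  exact hω.mono fun N hN => (not_le.1 hN).le

theorem eventually_card_deep_neighbours_le
    (hlaw : ∀ N σ, HasLaw (g N σ) (gaussianReal 0 1) P) (hindep : ∀ N, iIndepFun (g N) P)
    {ε δ : ℝ} (hε : 0 < ε) (hδ : 0 < δ) :
    ∀ᵐ ω ∂P, ∀ᶠ N : ℕ in atTop, ∀ σ : Config N,
      ((Finset.univ.filter fun j => potential (g N · ω) (flip j σ) < -(ε * N)).card : ℝ) ≤
        δ ^ 2 * N := by
  have hc : 0 < ε ^ 2 / 2 * δ ^ 2 := by positivity
  have hbound : ∀ᶠ N : ℕ in atTop,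
      (2 : ℝ) ^ N * (2 ^ N * Real.exp (-(N * (ε ^ 2 / 2) * (δ ^ 2 * N)))) ≤
        Real.exp (N * -1) := by
    filter_upwards [(tendsto_natCast_atTop_atTop.const_mul_atTop hc).eventually_ge_atTop
      (2 * Real.log 2 + 1)] with N hN
    rw [two_pow_eq_exp, ← Real.exp_add, ← Real.exp_add]
    gcongr
    nlinarith [mul_le_mul_of_nonneg_left hN N.cast_nonneg]
  filter_upwards [ae_eventually_notMem_of_summable (summable_exp_mul_neg one_pos)
    (hbound.mono fun N hN =>
      (measureReal_exists_lt_card_le (hlaw N) (hindep N) hε.le (δ ^ 2 * N)).trans hN)] with ω hω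
  exact hω.mono fun N hN σ => not_lt.1 fun hσ => hN ⟨σ, hσ⟩

end Asymptotics

section Limit

theorem exp_mul_pPAR (N : ℕ) (x : ℝ) : Real.exp (N * pPAR x) = Real.cosh x ^ N := by
  rw [pPAR, Real.exp_nat_mul, Real.exp_log (Real.cosh_pos x)]

variable {Ω : Type*} [MeasurableSpace Ω] {P : Measure Ω} [IsProbabilityMeasure P]
  {g : (N : ℕ) → Config N → Ω → ℝ}

theorem eventually_exp_le_partitionFunction (hlaw : ∀ N σ, HasLaw (g N σ) (gaussianReal 0 1) P)
    (hindep : ∀ N, iIndepFun (g N) P) {β η : ℝ} (Γ : ℝ) (hβ : 0 ≤ β) (hη : 0 < η) :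
    ∀ᵐ ω ∂P, ∀ᶠ N : ℕ in atTop,
      Real.exp (N * (pQREM β Γ - η)) ≤ partitionFunction β Γ (g N · ω) := by
  rcases max_choice (pREM β) (pPAR (β * Γ)) with h | h <;> rw [pQREM, h]
  · filter_upwards [eventually_exp_le_remPartition hlaw hindep hβ hη] with ω hω
    exact hω.mono fun N hN => hN.trans (remPartition_le_partitionFunction β Γ _)
  · filter_upwards [eventually_abs_averagePotential_le hlaw hindep
      (η := η / (β + 1)) (by positivity)] with ω hω
    filter_upwards [hω] with N hN
    have hU : β * averagePotential (g N · ω) ≤ N * η := by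
      calc β * averagePotential (g N · ω)
          ≤ (β + 1) * |averagePotential (g N · ω)| := by
            nlinarith [le_abs_self (averagePotential (g N · ω)),
              abs_nonneg (averagePotential (g N · ω))]
        _ ≤ (β + 1) * (N * (η / (β + 1))) := by gcongr
        _ = N * η := by field_simp
    refine le_trans ?_ (cosh_pow_mul_exp_le_partitionFunction β Γ _)
    rw [← exp_mul_pPAR, ← Real.exp_add]
    gcongr
    linarith

theorem eventually_partitionFunction_le (hlaw : ∀ N σ, HasLaw (g N σ) (gaussianReal 0 1) P)
    (hindep : ∀ N, iIndepFun (g N) P) {β η : ℝ} (Γ : ℝ) (hβ : 0 ≤ β) (hη : 0 < η) :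
    ∀ᵐ ω ∂P, ∀ᶠ N : ℕ in atTop,
      partitionFunction β Γ (g N · ω) ≤ Real.exp (N * (pQREM β Γ + η)) := by
  obtain ⟨ε, hε0, hε⟩ := exists_pos_mul_lt (by positivity : 0 < η / 4) β
  obtain ⟨δ, hδ0, hδ⟩ := exists_pos_mul_lt (by positivity : 0 < η / 4) (2 * |β * Γ|)
  have hlog : ∀ᶠ N : ℕ in atTop, Real.log 2 ≤ N * (η / 4) :=
    (tendsto_natCast_atTop_atTop.atTop_mul_const (by positivity)).eventually_ge_atTop _
  filter_upwards [eventually_card_deep_neighbours_le hlaw hindep hε0 hδ0,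
    eventually_remPartition_le hlaw β (by positivity : 0 < η / 4)] with ω hdeep hrem
  filter_upwards [hdeep, hrem, hlog] with N hdeepN hremN hlogN
  calc partitionFunction β Γ (g N · ω)
      ≤ Real.exp (N * (β * ε + 2 * |β * Γ| * δ)) *
          (Real.cosh (β * Γ) ^ N + remPartition β (g N · ω)) :=
        partitionFunction_le Γ hβ hε0.le hδ0.le hdeepN
    _ ≤ Real.exp (N * (η / 4 + η / 4)) *
          (Real.exp (N * (pQREM β Γ + η / 4)) + Real.exp (N * (pQREM β Γ + η / 4))) := by
        rw [← exp_mul_pPAR]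
        have hPAR : pPAR (β * Γ) ≤ pQREM β Γ + η / 4 :=
          (le_max_right _ _).trans (le_add_of_nonneg_right (by positivity))
        have hREM : pREM β ≤ pQREM β Γ := le_max_left _ _
        gcongr Real.exp (N * (?_ + ?_)) * (Real.exp (N * ?_) + ?_)
        · exact (add_pos (Real.exp_pos _) (remPartition_pos β _)).le
        · exact hremN.trans (by gcongr)
    _ = Real.exp (N * (η / 4 + η / 4) + (Real.log 2 + N * (pQREM β Γ + η / 4))) := by
        rw [Real.exp_add (N * (η / 4 + η / 4)), Real.exp_add (Real.log 2), Real.exp_log two_pos,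
          two_mul (Real.exp _)]
    _ ≤ Real.exp (N * (pQREM β Γ + η)) := by
        gcongr
        linarith

theorem abs_inv_mul_log_sub_le {n z m η : ℝ} (hn : 0 < n) (hlow : Real.exp (n * (m - η)) ≤ z)
    (hupp : z ≤ Real.exp (n * (m + η))) : |n⁻¹ * Real.log z - m| ≤ η := by
  have hz : 0 < z := (Real.exp_pos _).trans_le hlow
  rw [← Real.le_log_iff_exp_le hz, ← le_inv_mul_iff₀ hn] at hlow
  rw [← Real.log_le_iff_le_exp hz, ← inv_mul_le_iff₀ hn] at hupp
  exact abs_le.2 ⟨by linarith, by linarith⟩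

theorem ae_tendsto_pressure (hlaw : ∀ N σ, HasLaw (g N σ) (gaussianReal 0 1) P)
    (hindep : ∀ N, iIndepFun (g N) P) {β : ℝ} (Γ : ℝ) (hβ : 0 ≤ β) :
    ∀ᵐ ω ∂P, Tendsto (fun N : ℕ => pressure β Γ (g N · ω)) atTop (𝓝 (pQREM β Γ)) := by
  have hlow := ae_all_iff.2 fun k : ℕ =>
    eventually_exp_le_partitionFunction hlaw hindep Γ hβ (Nat.one_div_pos_of_nat (n := k))
  have hupp := ae_all_iff.2 fun k : ℕ =>
    eventually_partitionFunction_le hlaw hindep Γ hβ (Nat.one_div_pos_of_nat (n := k))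
  filter_upwards [hlow, hupp] with ω hlowω huppω
  refine Metric.tendsto_nhds.2 fun e he => ?_
  obtain ⟨k, hk⟩ := exists_nat_one_div_lt he
  filter_upwards [hlowω k, huppω k, eventually_gt_atTop 0] with N hlowN huppN hN
  exact (abs_inv_mul_log_sub_le (Nat.cast_pos.2 hN) hlowN huppN).trans_lt hk

end Limit

section PhaseTransitions

theorem pREM_pos {β : ℝ} (hβ : 0 < β) : 0 < pREM β := by
  have hc := betaC_pos
  rw [pREM_eq]
  nlinarith [lt_min hβ hc, min_le_left β betaC]

theorem one_lt_exp_pREM {β : ℝ} (hβ : 0 < β) : 1 < Real.exp (pREM β) :=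
  Real.one_lt_exp_iff.2 (pREM_pos hβ)

theorem gammaC_pos {β : ℝ} (hβ : 0 < β) : 0 < gammaC β :=
  mul_pos (inv_pos.2 hβ) (Real.arcosh_pos (one_lt_exp_pREM hβ))

theorem pPAR_mul_gammaC {β : ℝ} (hβ : 0 < β) : pPAR (β * gammaC β) = pREM β := by
  rw [gammaC, mul_inv_cancel_left₀ hβ.ne', pPAR, Real.cosh_arcosh (one_lt_exp_pREM hβ).le,
    Real.log_exp]

theorem pPAR_lt_pPAR {x y : ℝ} : pPAR x < pPAR y ↔ |x| < |y| := by
  rw [pPAR, pPAR, Real.log_lt_log_iff (Real.cosh_pos x) (Real.cosh_pos y), Real.cosh_lt_cosh]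

theorem pPAR_lt_pREM_iff {β Γ : ℝ} (hβ : 0 < β) :
    pPAR (β * Γ) < pREM β ↔ |Γ| < gammaC β := by
  rw [← pPAR_mul_gammaC hβ, pPAR_lt_pPAR, abs_mul, abs_mul, abs_of_pos (gammaC_pos hβ),
    mul_lt_mul_iff_right₀ (abs_pos.2 hβ.ne')]

theorem pREM_lt_pPAR_iff {β Γ : ℝ} (hβ : 0 < β) :
    pREM β < pPAR (β * Γ) ↔ gammaC β < |Γ| := by
  rw [← pPAR_mul_gammaC hβ, pPAR_lt_pPAR, abs_mul, abs_mul, abs_of_pos (gammaC_pos hβ),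
    mul_lt_mul_iff_right₀ (abs_pos.2 hβ.ne')]

theorem hasDerivAt_pPAR (x : ℝ) : HasDerivAt pPAR (Real.tanh x) x := by
  rw [Real.tanh_eq_sinh_div_cosh]
  exact (Real.hasDerivAt_cosh x).log (Real.cosh_pos x).ne'

theorem hasDerivWithinAt_pQREM_Iic_gammaC {β : ℝ} (hβ : 0 < β) :
    HasDerivWithinAt (pQREM β) 0 (Set.Iic (gammaC β)) (gammaC β) := by
  have hG := gammaC_pos hβ
  refine (hasDerivWithinAt_const (gammaC β) _ (pREM β)).congr_of_eventuallyEq ?_ ?_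
  · filter_upwards [self_mem_nhdsWithin, mem_nhdsWithin_of_mem_nhds (lt_mem_nhds hG)] with Γ hΓ hΓ0
    refine max_eq_left (not_lt.1 fun h => ?_)
    rw [pREM_lt_pPAR_iff hβ, abs_of_pos hΓ0] at h
    exact h.not_ge hΓ
  · rw [pQREM, pPAR_mul_gammaC hβ, max_self]

theorem hasDerivWithinAt_pQREM_Ici_gammaC {β : ℝ} (hβ : 0 < β) :
    HasDerivWithinAt (pQREM β) (β * Real.tanh (β * gammaC β))
      (Set.Ici (gammaC β)) (gammaC β) := by
  have hpar : HasDerivAt (fun Γ => pPAR (β * Γ)) (β * Real.tanh (β * gammaC β)) (gammaC β) := by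
    rw [mul_comm]
    exact (hasDerivAt_pPAR _).comp _ (hasDerivAt_const_mul β)
  refine hpar.hasDerivWithinAt.congr (fun Γ hΓ => max_eq_right (not_lt.1 fun h => ?_)) ?_
  · rw [pPAR_lt_pREM_iff hβ] at h
    exact ((le_abs_self Γ).trans_lt h).not_ge hΓ
  · rw [pQREM, pPAR_mul_gammaC hβ, max_self]

theorem tanh_pos_of_pos {x : ℝ} (hx : 0 < x) : 0 < Real.tanh x := by
  rw [Real.tanh_eq_sinh_div_cosh]
  exact div_pos (Real.sinh_pos_iff.2 hx) (Real.cosh_pos x)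

theorem pREM_add_min_mul_sub_le (β b : ℝ) : pREM β + min β betaC * (b - β) ≤ pREM b := by
  rw [pREM_eq, pREM_eq]
  rcases le_total β betaC with hβ | hβ <;> rcases le_total b betaC with hb | hb <;>
    simp only [min_eq_left, min_eq_right, hβ, hb] <;> nlinarith [sq_nonneg (b - β)]

/- The tangent lines at `β` and at `b` sandwich the increment of `pREM`, and the slope
`min β betaC` is a Lipschitz function of `β`. -/
theorem hasDerivAt_pREM (β : ℝ) : HasDerivAt pREM (min β betaC) β := by
  rw [hasDerivAt_iff_isLittleO]
  refine Asymptotics.IsBigO.trans_isLittleO (.of_bound 1 (.of_forall fun b => ?_))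
    (Asymptotics.isLittleO_pow_sub_sub β one_lt_two)
  have hlip : (min b betaC - min β betaC) * (b - β) ≤ (b - β) ^ 2 := by
    calc (min b betaC - min β betaC) * (b - β)
        ≤ |min b betaC - min β betaC| * |b - β| := (le_abs_self _).trans_eq (abs_mul _ _)
      _ ≤ |b - β| * |b - β| := by
          refine mul_le_mul_of_nonneg_right ?_ (abs_nonneg _)
          simpa using abs_min_sub_min_le_max b betaC β betaC
      _ = (b - β) ^ 2 := by rw [abs_mul_abs_self, sq]
  have hlow := pREM_add_min_mul_sub_le β b
  have hupp := pREM_add_min_mul_sub_le b β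
  rw [one_mul, smul_eq_mul, Real.norm_of_nonneg (by linarith), norm_pow, norm_norm,
    Real.norm_eq_abs, sq_abs]
  linarith

theorem hasDerivAt_pQREM_of_abs_lt_gammaC {β Γ : ℝ} (hβ : 0 < β) (hΓ : |Γ| < gammaC β) :
    HasDerivAt (pQREM · Γ) (min β betaC) β := by
  refine (hasDerivAt_pREM β).congr_of_eventuallyEq ?_
  have hpar : ContinuousAt (fun b => pPAR (b * Γ)) β :=
    (hasDerivAt_pPAR _).continuousAt.comp' (by fun_prop)
  filter_upwards [hpar.eventually_lt (hasDerivAt_pREM β).continuousAt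
    ((pPAR_lt_pREM_iff hβ).2 hΓ)] with b hb
  exact max_eq_left hb.le

theorem entropy_eq_zero_iff {β Γ : ℝ} (hβ : 0 < β) (hΓ : |Γ| < gammaC β) :
    Real.log 2 + pQREM β Γ - β * min β betaC = 0 ↔ betaC ≤ β := by
  have hentropy : Real.log 2 + pQREM β Γ - β * min β betaC =
      (betaC ^ 2 - min β betaC ^ 2) / 2 := by
    rw [pQREM, max_eq_left ((pPAR_lt_pREM_iff hβ).2 hΓ).le, pREM_eq, betaC_sq]
    ring
  rw [hentropy, div_eq_zero_iff, or_iff_left two_ne_zero, sub_eq_zero,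
    sq_eq_sq₀ betaC_pos.le (le_min hβ.le betaC_pos.le), eq_comm, min_eq_right_iff]

end PhaseTransitions

end QREM

theorem theorem1_general {Ω : Type*} [MeasurableSpace Ω] (P : Measure Ω) [IsProbabilityMeasure P]
    (g : (N : ℕ) → QREM.Config N → Ω → ℝ)
    (hlaw : ∀ (N : ℕ) (σ : QREM.Config N), HasLaw (g N σ) (gaussianReal 0 1) P)
    (hindep : ∀ N : ℕ, iIndepFun (g N) P) :
    (∀ β Γ : ℝ, 0 ≤ β → ∀ᵐ ω ∂P,
      Tendsto (fun N : ℕ => QREM.pressure β Γ (fun σ => g N σ ω)) atTop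
        (𝓝 (max (QREM.pREM β) (QREM.pPAR (β * Γ))))) ∧
    (∀ β : ℝ, 0 < β →
      (∀ Γ : ℝ,
        (QREM.pPAR (β * Γ) < QREM.pREM β ↔ |Γ| < QREM.gammaC β) ∧
        (QREM.pREM β < QREM.pPAR (β * Γ) ↔ QREM.gammaC β < |Γ|)) ∧
      HasDerivWithinAt (fun Γ => QREM.pQREM β Γ) 0
        (Set.Iic (QREM.gammaC β)) (QREM.gammaC β) ∧
      HasDerivWithinAt (fun Γ => QREM.pQREM β Γ) (β * Real.tanh (β * QREM.gammaC β))
        (Set.Ici (QREM.gammaC β)) (QREM.gammaC β) ∧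
      0 < β * Real.tanh (β * QREM.gammaC β)) ∧
    (∀ β Γ : ℝ, 0 < β → |Γ| < QREM.gammaC β →
      HasDerivAt (fun b => QREM.pQREM b Γ) (min β QREM.betaC) β ∧
      (Real.log 2 + QREM.pQREM β Γ - β * min β QREM.betaC = 0 ↔ QREM.betaC ≤ β)) :=
  ⟨fun _ Γ hβ => QREM.ae_tendsto_pressure hlaw hindep Γ hβ,
    fun _ hβ => ⟨fun _ => ⟨QREM.pPAR_lt_pREM_iff hβ, QREM.pREM_lt_pPAR_iff hβ⟩,
      QREM.hasDerivWithinAt_pQREM_Iic_gammaC hβ, QREM.hasDerivWithinAt_pQREM_Ici_gammaC hβ,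
      mul_pos hβ (QREM.tanh_pos_of_pos (mul_pos hβ (QREM.gammaC_pos hβ)))⟩,
    fun _ _ hβ hΓ => ⟨QREM.hasDerivAt_pQREM_of_abs_lt_gammaC hβ hΓ,
      QREM.entropy_eq_zero_iff hβ hΓ⟩⟩

/-- Limiting pressure of the quantum random energy model, with its first-order transition line
and its freezing transition. For each `N` the variables `g N σ` are i.i.d. standard Gaussian; the
joint law for different `N` is arbitrary. -/
theorem theorem1 {Ω : Type*} [MeasurableSpace Ω] (P : Measure Ω) [IsProbabilityMeasure P]
    (g : (N : ℕ) → QREM.Config N → Ω → ℝ)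
    (hlaw : ∀ (N : ℕ) (σ : QREM.Config N), HasLaw (g N σ) (gaussianReal 0 1) P)
    (hindep : ∀ N : ℕ, iIndepFun (g N) P) :
    -- almost sure convergence of the pressure to Goldschmidt's formula
    (∀ β Γ : ℝ, 0 ≤ β → 0 ≤ Γ → ∀ᵐ ω ∂P,
      Tendsto (fun N : ℕ => QREM.pressure β Γ (fun σ => g N σ ω)) atTop
        (𝓝 (max (QREM.pREM β) (QREM.pPAR (β * Γ))))) ∧
    -- the first-order transition: which term is the larger one changes at the critical field, where
    -- the derivative of the limit with respect to the field jumps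
    (∀ β : ℝ, 0 < β →
      (∀ Γ : ℝ, 0 ≤ Γ →
        (QREM.pPAR (β * Γ) < QREM.pREM β ↔ Γ < QREM.gammaC β) ∧
        (QREM.pREM β < QREM.pPAR (β * Γ) ↔ QREM.gammaC β < Γ)) ∧
      HasDerivWithinAt (fun Γ => QREM.pQREM β Γ) 0
        (Set.Iic (QREM.gammaC β)) (QREM.gammaC β) ∧
      HasDerivWithinAt (fun Γ => QREM.pQREM β Γ) (β * Real.tanh (β * QREM.gammaC β))
        (Set.Ici (QREM.gammaC β)) (QREM.gammaC β) ∧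
      0 < β * Real.tanh (β * QREM.gammaC β)) ∧
    -- the freezing transition: below the critical field the derivative of the limit in the inverse
    -- temperature saturates at `β_c`, and the entropy vanishes exactly from `β_c` on
    (∀ β Γ : ℝ, 0 < β → 0 ≤ Γ → Γ < QREM.gammaC β →
      HasDerivAt (fun b => QREM.pQREM b Γ) (min β QREM.betaC) β ∧
      (Real.log 2 + QREM.pQREM β Γ - β * min β QREM.betaC = 0 ↔ QREM.betaC ≤ β)) := by
  obtain ⟨hlim, hfield, hfreezing⟩ := theorem1_general P g hlaw hindep
  exact ⟨fun β Γ hβ _ => hlim β Γ hβ,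
    fun β hβ => (hfield β hβ).imp_left fun h Γ hΓ => by simpa only [abs_of_nonneg hΓ] using h Γ,
    fun β Γ hβ hΓ h => hfreezing β Γ hβ (by rwa [abs_of_nonneg hΓ])⟩
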